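/- Let $S$ be a scheme, let $r,m\ge 0$ and $n\ge 1$ be integers, and let $\mathscr F_1,\dots,\mathscr F_n$ be vector bundles (locally free sheaves of modules) of rank $r$ on $S$ and $\mathscr G_1,\dots,\mathscr G_n$ vector bundles of rank $m$ on $S$. For $i=1,\dots,n-1$ let $$f_i:\mathscr F_i\to\mathscr F_{i+1},\quad f^i:\mathscr F_{i+1}\to\mathscr F_i,\quad g_i:\mathscr G_i\to\mathscr G_{i+1},\quad g^i:\mathscr G_{i+1}\to\mathscr G_i$$ be homomorphisms. Suppose that there is an $s\in\Gamma(S,\mathscr O_S)$ such that: (I) $f_if^i=f^if_i=g_ig^i=g^ig_i=s\cdot\operatorname{id}$ (on the respective bundles) for all $i=1,\dots,n-1$; (II) for every $x\in S$ with $s=0$ in $\kappa(x)$ and every $i=1,\dots,n-1$, on the fibres over $x$ one has $\ker g_i=\operatorname{im} g^i$ in $\mathscr G_i\otimes\kappa(x)$ and $\ker g^i=\operatorname{im} g_i$ in $\mathscr G_{i+1}\otimes\kappa(x)$; (III) for every $x\in S$ with $s=0$ in $\kappa(x)$ and every $i=1,\dots,n-2$, in $\mathscr G_{i+1}\otimes\kappa(x)$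 the subspace $\operatorname{im} g_i$ is complementary to $\ker g_{i+1}$, and $\operatorname{im} g^{i+1}$ is complementary to $\ker g^i$. Let $\mathcal{LH}$ be the functor that sends an $S$-scheme $T$ to the $\Gamma(T,\mathscr O_T)$-module of tuples $(\varphi_i)_{1\le i\le n}$ of homomorphisms $\varphi_i:\mathscr F_i|_T\to\mathscr G_i|_T$ such that $\varphi_{i+1}\circ f_i=g_i\circ\varphi_i$ and $\varphi_i\circ f^i=g^i\circ\varphi_{i+1}$ for $i=1,\dots,n-1$, and that acts on morphisms by pullback. Then $\mathcal{LH}$ is represented by a vector bundle $LH$ on $S$ of rank $rm$. That is, $\mathcal{LH}$ is represented by an $S$-scheme $LH$, and every point of $S$ has an open neighbourhood $U$ with an isomorphism $LH|_U\cong\mathbb A^{rm}_U$ over $U$ for which the induced bijection $\mathcal{LH}(T)\to\Gamma(T,\mathscr O_T)^{rm}$ is $\Gamma(T,\mathscr O_T)$-linear for every $U$-scheme $T$. -/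

import Mathlib

open CategoryTheory Limits Opposite AlgebraicGeometry

universe u

noncomputable section

namespace LinkedHom

variable {X Y Z : Scheme.{u}}

/-! ### Scalars acting on homomorphisms of sheaves of modules -/

lemma smul_smul_comm (M : X.Modules) (U : X.Opens) (a b : Γ(X, U)) (v : Γ(M, U)) :
    a • b • v = b • a • v := by
  rw [smul_smul, smul_smul, mul_comm]

/-- Multiplication by a global function `a ∈ Γ(X, 𝒪_X)` on an `𝒪_X`-module `M`. -/
def scale (M : X.Modules) (a : Γ(X, ⊤)) : M ⟶ M where
  val := PresheafOfModules.homMk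
    { app := fun U => AddCommGrpCat.ofHom
        (DistribSMul.toAddMonoidHom Γ(M, U.unop) (X.presheaf.map (homOfLE le_top).op a))
      naturality := fun U V i => by
        ext v
        have := M.map_smul i.unop (X.presheaf.map (homOfLE le_top).op a) v
        rw [← ConcreteCategory.comp_apply (X.presheaf.map _), ← Functor.map_comp] at this
        exact this.symm }
    (fun U r v => smul_smul_comm M U.unop _ _ _)

lemma scale_app (M : X.Modules) (a : Γ(X, ⊤)) (U : X.Opens) (v : Γ(M, U)) :
    (scale M a).app U v = (X.presheaf.map (homOfLE le_top).op a : Γ(X, U)) • v := rfl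

/-- `Hom(M, N)` is a module over `Γ(X, 𝒪_X)`: a function acts by multiplying values. -/
instance homModule (M N : X.Modules) : Module Γ(X, ⊤) (M ⟶ N) where
  smul a φ := φ ≫ scale N a
  one_smul φ := by
    change φ ≫ scale N 1 = φ
    ext U v
    simp [scale_app]
  mul_smul a b φ := by
    change φ ≫ scale N (a * b) = (φ ≫ scale N b) ≫ scale N a
    ext U v
    simp only [Scheme.Modules.Hom.comp_app, ConcreteCategory.comp_apply, scale_app, map_mul,
      mul_smul]
  smul_zero a := by
    change (0 : M ⟶ N) ≫ scale N a = 0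
    simp
  smul_add a φ ψ := by
    change (φ + ψ) ≫ scale N a = φ ≫ scale N a + ψ ≫ scale N a
    simp
  add_smul a b φ := by
    change φ ≫ scale N (a + b) = φ ≫ scale N a + φ ≫ scale N b
    ext U v
    simp [scale_app, add_smul]
  zero_smul φ := by
    change φ ≫ scale N 0 = 0
    ext U v
    simp [scale_app]

lemma smul_app {M N : X.Modules} (a : Γ(X, ⊤)) (φ : M ⟶ N) (U : X.Opens) (v : Γ(M, U)) :
    (a • φ).app U v = (X.presheaf.map (homOfLE le_top).op a : Γ(X, U)) • φ.app U v := rfl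

lemma smul_comp' {M N P : X.Modules} (a : Γ(X, ⊤)) (φ : M ⟶ N) (ψ : N ⟶ P) :
    (a • φ) ≫ ψ = a • (φ ≫ ψ) := by
  ext U v
  simp [smul_app]

lemma comp_smul' {M N P : X.Modules} (a : Γ(X, ⊤)) (φ : M ⟶ N) (ψ : N ⟶ P) :
    φ ≫ (a • ψ) = a • (φ ≫ ψ) := by
  ext U v
  simp [smul_app]

/-! ### Vector bundles and fibres -/

/-- A vector bundle of rank `r` on `X`: an `𝒪_X`-module that is locally isomorphic to `𝒪_X ^ r`. -/
def IsVectorBundle (M : X.Modules) (r : ℕ) : Prop :=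
  ∀ x : X, ∃ U : X.Opens, x ∈ U ∧
    Nonempty ((Scheme.Modules.restrictFunctor U.ι).obj M ≅
      (SheafOfModules.free (R := U.toScheme.ringCatSheaf) (ULift.{u} (Fin r)) :
        U.toScheme.Modules))

/-- The fibre `M ⊗ κ(x)`, as a module over (the global functions on) `Spec κ(x)`. -/
abbrev Fibre (M : X.Modules) (x : X) : Type u :=
  Γ((Scheme.Modules.pullback (X.fromSpecResidueField x)).obj M, ⊤)

/-- The map `M ⊗ κ(x) → N ⊗ κ(x)` induced by `φ : M → N`. -/
def fibreMap {M N : X.Modules} (φ : M ⟶ N) (x : X) :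
    Fibre M x →ₗ[Γ(Spec (X.residueField x), ⊤)] Fibre N x where
  toFun v := ((Scheme.Modules.pullback (X.fromSpecResidueField x)).map φ).app ⊤ v
  map_add' v w := map_add _ v w
  map_smul' a v := Scheme.Modules.Hom.app_smul _ a v

/-! ### Restriction of homomorphisms along base change -/

/-- The canonical isomorphism `u^* f^* ≅ g^*` of pullback functors, when `g = f ∘ u`. -/
def pullbackIso (v : Z ⟶ Y) (f : Y ⟶ X) (g : Z ⟶ X) (h : v ≫ f = g) :
    Scheme.Modules.pullback f ⋙ Scheme.Modules.pullback v ≅ Scheme.Modules.pullback g :=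
  Scheme.Modules.pullbackComp v f ≪≫ Scheme.Modules.pullbackCongr h

/-- For `v : Z → Y` over `X`, the restriction to `Z` of a homomorphism `M|_Y → N|_Y`. -/
def resHom {M N : X.Modules} (v : Z ⟶ Y) (f : Y ⟶ X) (g : Z ⟶ X) (h : v ≫ f = g)
    (φ : (Scheme.Modules.pullback f).obj M ⟶ (Scheme.Modules.pullback f).obj N) :
    (Scheme.Modules.pullback g).obj M ⟶ (Scheme.Modules.pullback g).obj N :=
  (pullbackIso v f g h).inv.app M ≫ (Scheme.Modules.pullback v).map φ ≫
    (pullbackIso v f g h).hom.app N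

lemma resHom_map_comp {M N P : X.Modules} (v : Z ⟶ Y) (f : Y ⟶ X) (g : Z ⟶ X) (h : v ≫ f = g)
    (α : M ⟶ N)
    (φ : (Scheme.Modules.pullback f).obj N ⟶ (Scheme.Modules.pullback f).obj P) :
    resHom v f g h ((Scheme.Modules.pullback f).map α ≫ φ) =
      (Scheme.Modules.pullback g).map α ≫ resHom v f g h φ := by
  have := (pullbackIso v f g h).inv.naturality α
  simp only [Functor.comp_map] at this
  simp only [resHom, Functor.map_comp, Category.assoc, reassoc_of% this]

lemma resHom_comp_map {M N P : X.Modules} (v : Z ⟶ Y) (f : Y ⟶ X) (g : Z ⟶ X) (h : v ≫ f = g)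
    (φ : (Scheme.Modules.pullback f).obj M ⟶ (Scheme.Modules.pullback f).obj N) (α : N ⟶ P) :
    resHom v f g h (φ ≫ (Scheme.Modules.pullback f).map α) =
      resHom v f g h φ ≫ (Scheme.Modules.pullback g).map α := by
  have := (pullbackIso v f g h).hom.naturality α
  simp only [Functor.comp_map] at this
  simp only [resHom, Functor.map_comp, Category.assoc, this]

lemma pullbackIso_id_inv_app (M : X.Modules) (f : Y ⟶ X) (h : 𝟙 Y ≫ f = f) :
    (pullbackIso (𝟙 Y) f f h).inv.app M =
      (Scheme.Modules.pullbackId Y).inv.app ((Scheme.Modules.pullback f).obj M) := by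
  have := congr_app (Scheme.Modules.pseudofunctor_right_unitality f) M
  simp only [NatTrans.comp_app, Functor.whiskerLeft_app, Functor.rightUnitor_hom_app,
    eqToHom_app] at this
  rw [← cancel_mono ((Scheme.Modules.pullbackId Y).hom.app _)]
  simp only [Iso.inv_hom_id_app]
  simp only [pullbackIso, Scheme.Modules.pullbackCongr, Iso.trans_inv, NatTrans.comp_app,
    Category.assoc, eqToIso.inv, eqToHom_app]
  erw [Category.comp_id] at this
  rw [this]
  simp

lemma resHom_id {M N : X.Modules} (f : Y ⟶ X) (h : 𝟙 Y ≫ f = f)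
    (φ : (Scheme.Modules.pullback f).obj M ⟶ (Scheme.Modules.pullback f).obj N) :
    resHom (𝟙 Y) f f h φ = φ := by
  have := (Scheme.Modules.pullbackId Y).inv.naturality φ
  simp only [Functor.id_map] at this
  rw [resHom, pullbackIso_id_inv_app, ← reassoc_of% this, ← pullbackIso_id_inv_app N f h,
    Iso.inv_hom_id_app]
  exact Category.comp_id φ

lemma pullbackIso_comp_inv_app {W : Scheme.{u}} (M : X.Modules) (w : W ⟶ Z) (v : Z ⟶ Y)
    (f : Y ⟶ X) (g : Z ⟶ X) (k : W ⟶ X) (h : v ≫ f = g) (h' : w ≫ g = k)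
    (h'' : (w ≫ v) ≫ f = k) :
    (pullbackIso w g k h').inv.app M ≫
      (Scheme.Modules.pullback w).map ((pullbackIso v f g h).inv.app M) =
    (pullbackIso (w ≫ v) f k h'').inv.app M ≫
      (Scheme.Modules.pullbackComp w v).inv.app ((Scheme.Modules.pullback f).obj M) := by
  subst h h'
  have := congr_app (Scheme.Modules.pseudofunctor_associativity w v f) M
  simp only [NatTrans.comp_app, Functor.whiskerLeft_app, Functor.whiskerRight_app,
    Functor.associator_hom_app, eqToHom_app] at this
  erw [Category.id_comp] at this
  rw [← cancel_mono ((Scheme.Modules.pullbackComp w v).hom.app _),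
    ← cancel_mono ((Scheme.Modules.pullbackComp (w ≫ v) f).hom.app _)]
  simp only [pullbackIso, Scheme.Modules.pullbackCongr, Iso.trans_inv, NatTrans.comp_app,
    Category.assoc, eqToIso.inv, eqToHom_app, eqToHom_refl, Iso.inv_hom_id_app,
    Category.id_comp]
  erw [Category.id_comp, Category.id_comp, this, Iso.inv_hom_id_app]
  rfl

lemma resHom_comp {W : Scheme.{u}} {M N : X.Modules} (w : W ⟶ Z) (v : Z ⟶ Y) (f : Y ⟶ X)
    (g : Z ⟶ X) (k : W ⟶ X) (h : v ≫ f = g) (h' : w ≫ g = k) (h'' : (w ≫ v) ≫ f = k)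
    (φ : (Scheme.Modules.pullback f).obj M ⟶ (Scheme.Modules.pullback f).obj N) :
    resHom (w ≫ v) f k h'' φ = resHom w g k h' (resHom v f g h φ) := by
  have hM := pullbackIso_comp_inv_app M w v f g k h h' h''
  have hN := pullbackIso_comp_inv_app N w v f g k h h' h''
  have hN' : (Scheme.Modules.pullback w).map ((pullbackIso v f g h).hom.app N) ≫
      (pullbackIso w g k h').hom.app N =
      (Scheme.Modules.pullbackComp w v).hom.app ((Scheme.Modules.pullback f).obj N) ≫
        (pullbackIso (w ≫ v) f k h'').hom.app N := by
    have e : ((pullbackIso w g k h').inv.app N ≫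
        (Scheme.Modules.pullback w).map ((pullbackIso v f g h).inv.app N)) ≫
        (Scheme.Modules.pullback w).map ((pullbackIso v f g h).hom.app N) ≫
          (pullbackIso w g k h').hom.app N = 𝟙 _ := by
      rw [Category.assoc, ← Functor.map_comp_assoc, Iso.inv_hom_id_app]
      erw [CategoryTheory.Functor.map_id, Category.id_comp, Iso.inv_hom_id_app]
    have e' : ((pullbackIso (w ≫ v) f k h'').inv.app N ≫
        (Scheme.Modules.pullbackComp w v).inv.app ((Scheme.Modules.pullback f).obj N)) ≫
        (Scheme.Modules.pullbackComp w v).hom.app ((Scheme.Modules.pullback f).obj N) ≫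
        (pullbackIso (w ≫ v) f k h'').hom.app N = 𝟙 _ := by
      simp
    rw [hN] at e
    exact (cancel_epi _).1 (e.trans e'.symm)
  have nat := (Scheme.Modules.pullbackComp w v).inv.naturality φ
  simp only [Functor.comp_map] at nat
  simp only [resHom, Functor.map_comp, Category.assoc, hN']
  rw [reassoc_of% hM, ← reassoc_of% nat, Iso.inv_hom_id_app_assoc]

/-! ### Chains of bundles and the linked Hom functor -/

/-- A chain of `n` sheaves of modules on `S`, with homomorphisms in both directions between
neighbours. Indices start at `0`: `up i` goes from the `i`-th to the `(i+1)`-st module, and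
`down i` goes back. -/
structure Chain (S : Scheme.{u}) (n : ℕ) where
  obj : Fin n → S.Modules
  up : ∀ (i : ℕ) (hi : i + 1 < n), obj ⟨i, Nat.lt_of_succ_lt hi⟩ ⟶ obj ⟨i + 1, hi⟩
  down : ∀ (i : ℕ) (hi : i + 1 < n), obj ⟨i + 1, hi⟩ ⟶ obj ⟨i, Nat.lt_of_succ_lt hi⟩

variable {S : Scheme.{u}} {n : ℕ}

/-- For `T` over `S`, the `Γ(T, 𝒪_T)`-module of tuples `φ_i : F_i|_T → G_i|_T` that commute with
all the (pulled back) maps of the two chains. -/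
def linkedTuples (F G : Chain S n) (T : Over S) :
    Submodule Γ(T.left, ⊤) (∀ i : Fin n,
      (Scheme.Modules.pullback T.hom).obj (F.obj i) ⟶
        (Scheme.Modules.pullback T.hom).obj (G.obj i)) where
  carrier := {φ | ∀ (i : ℕ) (hi : i + 1 < n),
    (Scheme.Modules.pullback T.hom).map (F.up i hi) ≫ φ ⟨i + 1, hi⟩ =
      φ ⟨i, Nat.lt_of_succ_lt hi⟩ ≫ (Scheme.Modules.pullback T.hom).map (G.up i hi) ∧
    (Scheme.Modules.pullback T.hom).map (F.down i hi) ≫ φ ⟨i, Nat.lt_of_succ_lt hi⟩ =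
      φ ⟨i + 1, hi⟩ ≫ (Scheme.Modules.pullback T.hom).map (G.down i hi)}
  add_mem' {φ ψ} hφ hψ i hi := by
    simp only [Pi.add_apply, Preadditive.comp_add, Preadditive.add_comp]
    exact ⟨congrArg₂ _ (hφ i hi).1 (hψ i hi).1, congrArg₂ _ (hφ i hi).2 (hψ i hi).2⟩
  zero_mem' i hi := by simp
  smul_mem' a φ hφ i hi := by
    simp only [Pi.smul_apply, smul_comp', comp_smul', (hφ i hi).1, (hφ i hi).2, and_self]

/-- The linked Hom functor: it sends `T` over `S` to the set of tuples of homomorphisms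
`φ_i : F_i|_T → G_i|_T` commuting with the maps of the chains, and acts by restriction. -/
def linkedHom (F G : Chain S n) : (Over S)ᵒᵖ ⥤ Type u where
  obj T := linkedTuples F G T.unop
  map {T T'} v := ↾fun φ => ⟨fun i => resHom v.unop.left T.unop.hom T'.unop.hom (Over.w v.unop)
      (φ.1 i), fun i hi => by
    constructor
    · rw [← resHom_map_comp, ← resHom_comp_map, (φ.2 i hi).1]
    · rw [← resHom_map_comp, ← resHom_comp_map, (φ.2 i hi).2]⟩
  map_id T := by
    ext φ : 3
    apply Subtype.ext
    funext i
    exact resHom_id _ _ _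
  map_comp v w := by
    ext φ : 3
    apply Subtype.ext
    funext i
    exact resHom_comp _ _ _ _ _ _ _ _ _

instance (F G : Chain S n) (T : (Over S)ᵒᵖ) : AddCommGroup ((linkedHom F G).obj T) :=
  inferInstanceAs (AddCommGroup (linkedTuples F G T.unop))

instance (F G : Chain S n) (T : (Over S)ᵒᵖ) :
    Module Γ(T.unop.left, ⊤) ((linkedHom F G).obj T) :=
  inferInstanceAs (Module Γ(T.unop.left, ⊤) (linkedTuples F G T.unop))

/-- The conditions on two chains under which their linked Hom functor is a linked Hom space. -/
structure IsLinkedHom (F G : Chain S n) (s : Γ(S, ⊤)) : Prop where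
  /-- All composites of neighbouring opposite maps are multiplication by `s`. -/
  up_down : ∀ (i : ℕ) (hi : i + 1 < n),
    F.up i hi ≫ F.down i hi = s • 𝟙 _ ∧ F.down i hi ≫ F.up i hi = s • 𝟙 _ ∧
    G.up i hi ≫ G.down i hi = s • 𝟙 _ ∧ G.down i hi ≫ G.up i hi = s • 𝟙 _
  ker_eq : ∀ x : S, S.Γevaluation x s = 0 → ∀ (i : ℕ) (hi : i + 1 < n),
    LinearMap.ker (fibreMap (G.up i hi) x) = LinearMap.range (fibreMap (G.down i hi) x) ∧
    LinearMap.ker (fibreMap (G.down i hi) x) = LinearMap.range (fibreMap (G.up i hi) x)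
  compl : ∀ x : S, S.Γevaluation x s = 0 → ∀ (i : ℕ) (hi : i + 2 < n),
    IsCompl (LinearMap.range (fibreMap (G.up i (Nat.lt_of_succ_lt hi)) x))
      (LinearMap.ker (fibreMap (G.up (i + 1) hi) x)) ∧
    IsCompl (LinearMap.range (fibreMap (G.down (i + 1) hi) x))
      (LinearMap.ker (fibreMap (G.down i (Nat.lt_of_succ_lt hi)) x))

/-! ### Representability by a vector bundle -/

section Represented

variable {P : (Over S)ᵒᵖ ⥤ Type u} {L : Over S} (h : P.RepresentableBy L) {k : ℕ}
  {U : S.Opens}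

/-- Let `L` represent `P`, and let `e` be an isomorphism over `U` from `L|_U` to the affine space
`𝔸 ^ k` over `U`. For `T` over `U`, an element of `P(T)` is a morphism `T → L` over `S`, hence a
morphism `T → L|_U` over `U`, and so `e` gives it `k` coordinates in `Γ(T, 𝒪_T)`. -/
def coords (e : (Over.pullback U.ι).obj L ≅
      Over.mk (𝔸(ULift.{u} (Fin k); U.toScheme) ↘ U.toScheme))
    (T : Over U.toScheme) (a : P.obj (op ((Over.map U.ι).obj T))) : Fin k → Γ(((Over.map U.ι).obj T).left, ⊤) :=
  fun j => ((Over.mapPullbackAdj U.ι).homEquiv T L (h.homEquiv.symm a) ≫ e.hom).left.appTop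
    (AffineSpace.coord U.toScheme (ULift.up j))

/-- Let the values `P(T)` of a functor on `S`-schemes be modules over `Γ(T, 𝒪_T)`. The functor is
represented by a vector bundle of rank `k` if it is represented by an `S`-scheme `L` which, locally
on `S`, is isomorphic to the affine space `𝔸 ^ k` in such a way that the coordinates
`P(T) → Γ(T, 𝒪_T) ^ k` are linear for all `T`. -/
def RepresentedByVectorBundle (P : (Over S)ᵒᵖ ⥤ Type u)
    [∀ T, AddCommGroup (P.obj T)]
    [∀ T : (Over S)ᵒᵖ, Module Γ(T.unop.left, ⊤) (P.obj T)] (k : ℕ) : Prop :=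
  ∃ (L : Over S) (h : P.RepresentableBy L), ∀ x : S, ∃ U : S.Opens, x ∈ U ∧
    ∃ e : (Over.pullback U.ι).obj L ≅
        Over.mk (𝔸(ULift.{u} (Fin k); U.toScheme) ↘ U.toScheme),
      ∀ T : Over U.toScheme, IsLinearMap Γ(((Over.map U.ι).obj T).left, ⊤) (coords h e T)

end Represented

end LinkedHom

end

/-! Locally on `S` all the bundles have bases, and the chains become chains of square matrices. The
key point is that near any `x` all the `G_i` can be identified with one free module of rank `m` by
means of the composites to the two ends of the chain alone: there are matrices `P`, `Q` such that
`theta_i = P ∘ (G_i → G_first) + Q ∘ (G_i → G_last)` is invertible for every `i`, and an idempotent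
`E` with `EP = P`, `EQ = 0`. A linked tuple slides past these composites, so `theta_i φ_i` depends
only on `P φ_first` and `Q φ_last`, and `E` recovers both from the sum `C = P φ_first + Q φ_last`.
Conversely, any `m × r` matrix `C` determines candidates `φ_i`, and condition (I) makes them linked.
Thus the entries of `C` are `rm` free linear coordinates (`Splitting.outer_bijective`).

To find `P` and `Q`, look at the fibre over `x`. If `s ≠ 0` there, all maps of the chain are
invertible, and `P = 1`, `Q = 0` will do. If `s = 0`, then by (II) and (III) all upward maps of `G`
have the same rank, and this rank and that of the first downward map add up to `m`. So one can let
`P` take values in a set `J` of coordinates and be injective on the image of the first downward map,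
and let `Q` take values in the other coordinates and be injective on the image of the last upward
map. A vector of `G_i` killed by `theta_i` is then killed by every map of the chain out of `G_i`.
For interior `i` it vanishes by exactness and complementarity, at the two ends by exactness and
injectivity of `P` or `Q` (`exists_isUnit_theta`). Lifting `P` and `Q` to a neighbourhood keeps the
determinants of the `theta_i` invertible after shrinking (`exists_splitting`).

These coordinates commute with base change, so over such a neighbourhood the functor is an affine
space. Homomorphisms glue along open covers (`isZariskiSheaf_linkedHom`), hence the local affine
spaces glue to a representing scheme (`exists_representableBy`), whose local coordinates are the
linear ones above (`coords_eq`). -/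

noncomputable section

namespace LinkedHom

/-! ### Pullback of sections and its compatibility with composition -/

section Sections

variable {X Y Z W : Scheme.{u}}

/-- The unit `M → v_* v^* M` of the adjunction between pullback and pushforward. -/
abbrev adjUnit (v : Z ⟶ Y) (M : Y.Modules) :
    M ⟶ (Scheme.Modules.pushforward v).obj ((Scheme.Modules.pullback v).obj M) :=
  (Scheme.Modules.pullbackPushforwardAdjunction v).unit.app M

/-- The pullback of a section of `M` along `v`. -/
def unitSec (v : Z ⟶ Y) {M : Y.Modules} (V : Y.Opens) (x : Γ(M, V)) :
    Γ((Scheme.Modules.pullback v).obj M, v ⁻¹ᵁ V) :=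
  (adjUnit v M).app V x

lemma unitSec_add (v : Z ⟶ Y) {M : Y.Modules} (V : Y.Opens) (x y : Γ(M, V)) :
    unitSec v V (x + y) = unitSec v V x + unitSec v V y :=
  map_add _ x y

lemma unitSec_smul (v : Z ⟶ Y) {M : Y.Modules} (V : Y.Opens) (a : Γ(Y, V)) (x : Γ(M, V)) :
    unitSec v V (a • x) = (v.app V a : Γ(Z, v ⁻¹ᵁ V)) • unitSec v V x :=
  Scheme.Modules.Hom.app_smul (adjUnit v M) a x

lemma hom_naturality {M N : X.Modules} (φ : M ⟶ N) {U V : X.Opens} (i : U ⟶ V) (x : Γ(M, V)) :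
    φ.app U (M.presheaf.map i.op x) = N.presheaf.map i.op (φ.app V x) :=
  ConcreteCategory.congr_hom (φ.mapPresheaf.naturality i.op) x

lemma app_comp_apply {M N P : X.Modules} (φ : M ⟶ N) (ψ : N ⟶ P) (U : X.Opens) (x : Γ(M, U)) :
    (φ ≫ ψ).app U x = ψ.app U (φ.app U x) := by
  rw [Scheme.Modules.Hom.comp_app, ConcreteCategory.comp_apply]

lemma unitSec_res (v : Z ⟶ Y) {M : Y.Modules} {U V : Y.Opens} (i : U ⟶ V)
    (i' : v ⁻¹ᵁ U ⟶ v ⁻¹ᵁ V) (x : Γ(M, V)) :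
    unitSec v U (M.presheaf.map i.op x) =
      ((Scheme.Modules.pullback v).obj M).presheaf.map i'.op (unitSec v V x) :=
  hom_naturality (adjUnit v M) i x

lemma unitSec_map (v : Z ⟶ Y) {M N : Y.Modules} (φ : M ⟶ N) (V : Y.Opens) (x : Γ(M, V)) :
    ((Scheme.Modules.pullback v).map φ).app _ (unitSec v V x) = unitSec v V (φ.app V x) := by
  have := (Scheme.Modules.pullbackPushforwardAdjunction v).unit.naturality φ
  exact ConcreteCategory.congr_hom (congrArg (fun ψ => Scheme.Modules.Hom.app ψ V) this.symm) x

/-- The canonical map `w^* v^* M → (w ≫ v)^* M`. -/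
def compTo (w : W ⟶ Z) (v : Z ⟶ Y) (M : Y.Modules) :
    (Scheme.Modules.pullback w).obj ((Scheme.Modules.pullback v).obj M) ⟶
      (Scheme.Modules.pullback (w ≫ v)).obj M :=
  (Scheme.Modules.pullbackComp w v).hom.app M

/-- The isomorphism `w^* v^* ≅ (w ≫ v)^*` is conjugate to the one for pushforwards, and conjugate
transformations are compatible with the units of the adjunctions. -/
lemma adjUnit_comp (w : W ⟶ Z) (v : Z ⟶ Y) (M : Y.Modules) :
    adjUnit v M ≫ (Scheme.Modules.pushforward v).map (adjUnit w _) ≫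
      (Scheme.Modules.pushforwardComp w v).hom.app _ ≫
      (Scheme.Modules.pushforward (w ≫ v)).map (compTo w v M) = adjUnit (w ≫ v) M := by
  have h := unit_conjugateEquiv ((Scheme.Modules.pullbackPushforwardAdjunction v).comp
    (Scheme.Modules.pullbackPushforwardAdjunction w))
    (Scheme.Modules.pullbackPushforwardAdjunction (w ≫ v))
    (Scheme.Modules.pullbackComp w v).inv M
  rw [Scheme.Modules.conjugateEquiv_pullbackComp_inv, Adjunction.comp_unit_app] at h
  have h' := congrArg (fun ψ => ψ ≫ (Scheme.Modules.pushforward (w ≫ v)).map (compTo w v M)) h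
  simp only [Category.assoc, ← Functor.map_comp] at h'
  refine h'.trans ?_
  erw [Iso.inv_hom_id_app, CategoryTheory.Functor.map_id]
  exact Category.comp_id _

lemma unitSec_comp (w : W ⟶ Z) (v : Z ⟶ Y) {M : Y.Modules} (V : Y.Opens) (x : Γ(M, V)) :
    (compTo w v M).app _ (unitSec w (v ⁻¹ᵁ V) (unitSec v V x)) =
      unitSec (w ≫ v) V x :=
  ConcreteCategory.congr_hom
    (congrArg (fun ψ => Scheme.Modules.Hom.app ψ V) (adjUnit_comp w v M)) x

lemma pullbackIso_comp_hom_app (M : X.Modules) (w : W ⟶ Z) (v : Z ⟶ Y)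
    (f : Y ⟶ X) (g : Z ⟶ X) (k : W ⟶ X) (h : v ≫ f = g) (h' : w ≫ g = k)
    (h'' : (w ≫ v) ≫ f = k) :
    (Scheme.Modules.pullback w).map ((pullbackIso v f g h).hom.app M) ≫
      (pullbackIso w g k h').hom.app M =
    (Scheme.Modules.pullbackComp w v).hom.app ((Scheme.Modules.pullback f).obj M) ≫
      (pullbackIso (w ≫ v) f k h'').hom.app M := by
  have hM := pullbackIso_comp_inv_app M w v f g k h h' h''
  have e : ((pullbackIso w g k h').inv.app M ≫
      (Scheme.Modules.pullback w).map ((pullbackIso v f g h).inv.app M)) ≫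
      (Scheme.Modules.pullback w).map ((pullbackIso v f g h).hom.app M) ≫
        (pullbackIso w g k h').hom.app M = 𝟙 _ := by
    rw [Category.assoc, ← Functor.map_comp_assoc, Iso.inv_hom_id_app]
    erw [CategoryTheory.Functor.map_id, Category.id_comp, Iso.inv_hom_id_app]
  have e' : ((pullbackIso (w ≫ v) f k h'').inv.app M ≫
      (Scheme.Modules.pullbackComp w v).inv.app ((Scheme.Modules.pullback f).obj M)) ≫
      (Scheme.Modules.pullbackComp w v).hom.app ((Scheme.Modules.pullback f).obj M) ≫
      (pullbackIso (w ≫ v) f k h'').hom.app M = 𝟙 _ := by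
    simp
  rw [hM] at e
  exact (cancel_epi _).1 (e.trans e'.symm)

/-- The canonical isomorphism `v^* f^* M → g^* M` for `g = v ≫ f`. -/
def pullbackTo (v : Z ⟶ Y) (f : Y ⟶ X) (g : Z ⟶ X) (h : v ≫ f = g) (M : X.Modules) :
    (Scheme.Modules.pullback v).obj ((Scheme.Modules.pullback f).obj M) ⟶
      (Scheme.Modules.pullback g).obj M :=
  (pullbackIso v f g h).hom.app M

instance (v : Z ⟶ Y) (f : Y ⟶ X) (g : Z ⟶ X) (h : v ≫ f = g) (M : X.Modules) :
    IsIso (pullbackTo v f g h M) :=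
  inferInstanceAs (IsIso ((pullbackIso v f g h).hom.app M))

lemma map_pullbackTo (M : X.Modules) (w : W ⟶ Z) (v : Z ⟶ Y)
    (f : Y ⟶ X) (g : Z ⟶ X) (k : W ⟶ X) (h : v ≫ f = g) (h' : w ≫ g = k)
    (h'' : (w ≫ v) ≫ f = k) :
    (Scheme.Modules.pullback w).map (pullbackTo v f g h M) ≫ pullbackTo w g k h' M =
      compTo w v _ ≫ pullbackTo (w ≫ v) f k h'' M :=
  pullbackIso_comp_hom_app M w v f g k h h' h''

lemma pullbackTo_naturality (v : Z ⟶ Y) (f : Y ⟶ X) (g : Z ⟶ X) (h : v ≫ f = g) {M N : X.Modules}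
    (α : M ⟶ N) :
    (Scheme.Modules.pullback v).map ((Scheme.Modules.pullback f).map α) ≫ pullbackTo v f g h N =
      pullbackTo v f g h M ≫ (Scheme.Modules.pullback g).map α :=
  (pullbackIso v f g h).hom.naturality α

lemma pullbackTo_resHom (v : Z ⟶ Y) (f : Y ⟶ X) (g : Z ⟶ X) (h : v ≫ f = g) {M N : X.Modules}
    (φ : (Scheme.Modules.pullback f).obj M ⟶ (Scheme.Modules.pullback f).obj N) :
    pullbackTo v f g h M ≫ resHom v f g h φ =
      (Scheme.Modules.pullback v).map φ ≫ pullbackTo v f g h N :=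
  ((pullbackIso v f g h).app M).hom_inv_id_assoc _

/-- For `v : Z → Y` over `X`, the restriction to `Z` of a section of `M|_Y`. -/
def pullSec (v : Z ⟶ Y) (f : Y ⟶ X) (g : Z ⟶ X) (h : v ≫ f = g) {M : X.Modules} (V : Y.Opens)
    (x : Γ((Scheme.Modules.pullback f).obj M, V)) :
    Γ((Scheme.Modules.pullback g).obj M, v ⁻¹ᵁ V) :=
  (pullbackTo v f g h M).app _ (unitSec v V x)

lemma pullSec_eq : @pullSec.{u} = fun {_ _ _} v f g h {M} V x =>
    (pullbackTo v f g h M).app _ (unitSec v V x) := rfl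

lemma pullSec_def (v : Z ⟶ Y) (f : Y ⟶ X) (g : Z ⟶ X) (h : v ≫ f = g) {M : X.Modules}
    (V : Y.Opens) (x : Γ((Scheme.Modules.pullback f).obj M, V)) :
    pullSec v f g h V x = (pullbackTo v f g h M).app (v ⁻¹ᵁ V) (unitSec v V x) := by
  rw [pullSec_eq]

section

variable (v : Z ⟶ Y) (f : Y ⟶ X) (g : Z ⟶ X) (h : v ≫ f = g) {M N : X.Modules} {V : Y.Opens}

lemma pullSec_add (x y : Γ((Scheme.Modules.pullback f).obj M, V)) :
    pullSec v f g h V (x + y) = pullSec v f g h V x + pullSec v f g h V y := by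
  simp only [pullSec_def, unitSec_add, map_add]

lemma pullSec_smul (a : Γ(Y, V)) (x : Γ((Scheme.Modules.pullback f).obj M, V)) :
    pullSec v f g h V (a • x) = (v.app V a : Γ(Z, v ⁻¹ᵁ V)) • pullSec v f g h V x := by
  simp only [pullSec_def, unitSec_smul]
  exact Scheme.Modules.Hom.app_smul _ _ _

lemma pullSec_res {U : Y.Opens} (i : U ⟶ V) (i' : v ⁻¹ᵁ U ⟶ v ⁻¹ᵁ V)
    (x : Γ((Scheme.Modules.pullback f).obj M, V)) :
    pullSec v f g h U (((Scheme.Modules.pullback f).obj M).presheaf.map i.op x) =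
      ((Scheme.Modules.pullback g).obj M).presheaf.map i'.op (pullSec v f g h V x) := by
  rw [pullSec_def, pullSec_def, unitSec_res v i i', hom_naturality]

lemma resHom_pullSec
    (φ : (Scheme.Modules.pullback f).obj M ⟶ (Scheme.Modules.pullback f).obj N)
    (x : Γ((Scheme.Modules.pullback f).obj M, V)) :
    (resHom v f g h φ).app _ (pullSec v f g h V x) = pullSec v f g h V (φ.app V x) := by
  rw [pullSec_def, pullSec_def, ← unitSec_map, ← app_comp_apply, ← app_comp_apply,
    pullbackTo_resHom]

/-- The cocycle identity `map_pullbackTo` for the pullback isomorphisms, evaluated on pulled back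
sections by means of `unitSec_comp`. -/
lemma pullSec_comp (w : W ⟶ Z) (k : W ⟶ X) (h' : w ≫ g = k) (h'' : (w ≫ v) ≫ f = k)
    (x : Γ((Scheme.Modules.pullback f).obj M, V)) :
    pullSec w g k h' (v ⁻¹ᵁ V) (pullSec v f g h V x) = pullSec (w ≫ v) f k h'' V x := by
  rw [pullSec_def, pullSec_def, pullSec_def, ← unitSec_comp, ← unitSec_map]
  rw [← app_comp_apply, map_pullbackTo M w v f g k h h' h'', app_comp_apply]
  rfl

end

end Sections

/-! ### Frames, and homomorphisms as matrices of global functions -/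

section Frames

variable {X Y Z W : Scheme.{u}} {ι κ : Type*}

/-- The map on global sections induced by a homomorphism. -/
def secLin {M N : X.Modules} (φ : M ⟶ N) : Γ(M, ⊤) →ₗ[Γ(X, ⊤)] Γ(N, ⊤) where
  toFun x := φ.app ⊤ x
  map_add' x y := map_add _ x y
  map_smul' a x := Scheme.Modules.Hom.app_smul φ a x

lemma secLin_apply {M N : X.Modules} (φ : M ⟶ N) (x : Γ(M, ⊤)) : secLin φ x = φ.app ⊤ x := rfl

lemma secLin_comp {M N P : X.Modules} (φ : M ⟶ N) (ψ : N ⟶ P) :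
    secLin (φ ≫ ψ) = secLin ψ ∘ₗ secLin φ := rfl

lemma secLin_id (M : X.Modules) : secLin (𝟙 M) = LinearMap.id := rfl

lemma secLin_add {M N : X.Modules} (φ ψ : M ⟶ N) : secLin (φ + ψ) = secLin φ + secLin ψ := rfl

lemma secLin_smul {M N : X.Modules} (a : Γ(X, ⊤)) (φ : M ⟶ N) :
    secLin (a • φ) = a • secLin φ := by
  ext x
  rw [secLin_apply, smul_app, LinearMap.smul_apply, secLin_apply]
  have : (homOfLE (le_top : (⊤ : X.Opens) ≤ ⊤)).op = 𝟙 _ := Subsingleton.elim _ _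
  rw [this, CategoryTheory.Functor.map_id]
  rfl

/-- A frame of a module `M`: a family of global sections that freely generates `M`. -/
structure Frame (M : X.Modules) (ι : Type*) where
  /-- the sections of the frame -/
  sec : ι → Γ(M, ⊤)
  bijective : ∀ N : X.Modules, Function.Bijective fun (φ : M ⟶ N) (j : ι) => secLin φ (sec j)

/-- Global sections of `M` are global sections of the underlying presheaf of modules. -/
def sectionsTop (M : X.Modules) : SheafOfModules.sections M ≃ Γ(M, ⊤) where
  toFun s := s.val (op ⊤)
  invFun x := PresheafOfModules.sectionsMk (fun U => M.presheaf.map (homOfLE le_top).op x) (by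
    intro U V i
    have : (homOfLE (le_top : V.unop ≤ ⊤)).op = (homOfLE (le_top : U.unop ≤ ⊤)).op ≫ i :=
      Subsingleton.elim _ _
    rw [this, Functor.map_comp]
    rfl)
  left_inv s := by
    ext U
    exact PresheafOfModules.sections_property s _
  right_inv x := by
    have : (homOfLE (le_top : (⊤ : X.Opens) ≤ ⊤)).op = 𝟙 _ := Subsingleton.elim _ _
    change M.presheaf.map (homOfLE (le_top : (⊤ : X.Opens) ≤ ⊤)).op x = x
    rw [this, CategoryTheory.Functor.map_id]
    rfl

/-- The frame of a free module. -/
def freeFrame (X : Scheme.{u}) (I : Type u) :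
    Frame (X := X) (SheafOfModules.free (R := X.ringCatSheaf) I) I where
  sec i := sectionsTop _ (SheafOfModules.freeSection i)
  bijective N := by
    have := (((SheafOfModules.freeHomEquiv (R := X.ringCatSheaf) N (I := I))).trans
      (Equiv.arrowCongr (Equiv.refl I) (sectionsTop N))).bijective
    exact this

/-- Transport of a frame along an isomorphism. -/
def Frame.ofIso {M N : X.Modules} (E : Frame M ι) (e : M ≅ N) : Frame N ι where
  sec j := secLin e.hom (E.sec j)
  bijective P := by
    have := (E.bijective P).comp (e.homFromEquiv (Z := P)).symm.bijective
    exact this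

/-- Reindexing of a frame. -/
def Frame.reindex {M : X.Modules} (E : Frame M ι) (e : ι ≃ κ) : Frame M κ where
  sec j := E.sec (e.symm j)
  bijective P := by
    have := (e.arrowCongr (Equiv.refl Γ(P, ⊤))).bijective.comp (E.bijective P)
    exact this

/-- The pullback of a global section of `M`. -/
def unitTop (v : Z ⟶ Y) {M : Y.Modules} (x : Γ(M, ⊤)) :
    Γ((Scheme.Modules.pullback v).obj M, ⊤) :=
  unitSec v ⊤ x

/-- The pullback of a frame. -/
def Frame.pullback {M : Y.Modules} (E : Frame M ι) (v : Z ⟶ Y) :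
    Frame ((Scheme.Modules.pullback v).obj M) ι where
  sec j := unitTop v (E.sec j)
  bijective P := by
    -- By adjunction, maps from the pullback to `P` are maps from `M` to the pushforward of `P`.
    -- This is why a frame is defined by its universal property against all modules.
    have := (E.bijective _).comp
      ((Scheme.Modules.pullbackPushforwardAdjunction v).homEquiv M P).bijective
    exact this

/-- The restriction to `Z` of a global section of `M|_Y`, for `v : Z → Y` over `X`. -/
def pullTop (v : Z ⟶ Y) (f : Y ⟶ X) (g : Z ⟶ X) (h : v ≫ f = g) {M : X.Modules}
    (x : Γ((Scheme.Modules.pullback f).obj M, ⊤)) :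
    Γ((Scheme.Modules.pullback g).obj M, ⊤) :=
  pullSec v f g h ⊤ x

lemma pullTop_eq : @pullTop.{u} = fun {_ _ _} v f g h {_} x => pullSec v f g h ⊤ x := rfl

lemma pullTop_def (v : Z ⟶ Y) (f : Y ⟶ X) (g : Z ⟶ X) (h : v ≫ f = g) {M : X.Modules}
    (x : Γ((Scheme.Modules.pullback f).obj M, ⊤)) : pullTop v f g h x = pullSec v f g h ⊤ x := by
  rw [pullTop_eq]

section

variable (v : Z ⟶ Y) (f : Y ⟶ X) (g : Z ⟶ X) (h : v ≫ f = g) {M N : X.Modules}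

lemma pullTop_add (x y : Γ((Scheme.Modules.pullback f).obj M, ⊤)) :
    pullTop v f g h (x + y) = pullTop v f g h x + pullTop v f g h y := by
  rw [pullTop_def, pullTop_def, pullTop_def]
  exact pullSec_add v f g h x y

lemma pullTop_smul (a : Γ(Y, ⊤)) (x : Γ((Scheme.Modules.pullback f).obj M, ⊤)) :
    pullTop v f g h (a • x) = (v.appTop a : Γ(Z, ⊤)) • pullTop v f g h x := by
  rw [pullTop_def, pullTop_def]
  exact pullSec_smul v f g h a x

lemma resHom_pullTop
    (φ : (Scheme.Modules.pullback f).obj M ⟶ (Scheme.Modules.pullback f).obj N)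
    (x : Γ((Scheme.Modules.pullback f).obj M, ⊤)) :
    secLin (resHom v f g h φ) (pullTop v f g h x) = pullTop v f g h (secLin φ x) := by
  rw [secLin_apply, secLin_apply, pullTop_def, pullTop_def]
  exact resHom_pullSec v f g h φ x

lemma pullTop_comp (w : W ⟶ Z) (k : W ⟶ X) (h' : w ≫ g = k) (h'' : (w ≫ v) ≫ f = k)
    (x : Γ((Scheme.Modules.pullback f).obj M, ⊤)) :
    pullTop w g k h' (pullTop v f g h x) = pullTop (w ≫ v) f k h'' x := by
  rw [pullTop_def, pullTop_def, pullTop_def]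
  exact pullSec_comp v f g h w k h' h'' x

/-- The restriction to `Z` of a frame of `M|_Y`, for `v : Z → Y` over `X`. -/
def Frame.pull (E : Frame ((Scheme.Modules.pullback f).obj M) ι) :
    Frame ((Scheme.Modules.pullback g).obj M) ι where
  sec j := pullTop v f g h (E.sec j)
  bijective P := by
    have e : ∀ j, pullTop v f g h (E.sec j) =
        secLin (pullbackTo v f g h M) (unitTop v (E.sec j)) := fun j => by
      rw [secLin_apply, pullTop_def, pullSec_def]
      rfl
    simp only [e]
    exact ((E.pullback v).ofIso (asIso (pullbackTo v f g h M))).bijective P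

lemma Frame.pull_sec (E : Frame ((Scheme.Modules.pullback f).obj M) ι) (j : ι) :
    (E.pull v f g h).sec j = pullTop v f g h (E.sec j) := rfl

end

variable (X) in
/-- The structure sheaf as a module over itself. -/
abbrev structureModule : X.Modules := SheafOfModules.unit X.ringCatSheaf

variable (X) in
/-- The section `1` of the structure sheaf. -/
def oneSec : Γ(structureModule X, ⊤) := (1 : Γ(X, ⊤))

variable (X) in
/-- The sections of the structure sheaf. -/
def structureSec : Γ(structureModule X, ⊤) ≃ₗ[Γ(X, ⊤)] Γ(X, ⊤) where
  toFun x := x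
  invFun x := x
  map_add' _ _ := rfl
  map_smul' _ _ := rfl
  left_inv _ := rfl
  right_inv _ := rfl

lemma structureSec_smul_oneSec (x : Γ(structureModule X, ⊤)) :
    structureSec X x • oneSec X = x :=
  mul_one (structureSec X x)

lemma structureSec_oneSec : structureSec X (oneSec X) = 1 := rfl

/-- The homomorphism `𝒪 → N` given by a section of `N`. -/
def mulSec {N : X.Modules} (w : Γ(N, ⊤)) : structureModule X ⟶ N :=
  (SheafOfModules.unitHomEquiv (R := X.ringCatSheaf) N).symm ((sectionsTop N).symm w)

lemma secLin_mulSec_oneSec {N : X.Modules} (w : Γ(N, ⊤)) : secLin (mulSec w) (oneSec X) = w := by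
  have h := (SheafOfModules.unitHomEquiv (R := X.ringCatSheaf) N).apply_symm_apply
    ((sectionsTop N).symm w)
  exact (congrArg (sectionsTop N) h).trans ((sectionsTop N).apply_symm_apply w)

lemma secLin_mulSec {N : X.Modules} (w : Γ(N, ⊤)) (x : Γ(structureModule X, ⊤)) :
    secLin (mulSec w) x = structureSec X x • w := by
  conv_lhs => rw [← structureSec_smul_oneSec x, map_smul, secLin_mulSec_oneSec]

variable [DecidableEq ι]

/-- The coordinate functions of a frame. -/
def Frame.coord {M : X.Modules} (E : Frame M ι) (k : ι) : M ⟶ structureModule X :=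
  (Equiv.ofBijective _ (E.bijective (structureModule X))).symm (Pi.single k (oneSec X))

lemma Frame.coord_sec {M : X.Modules} (E : Frame M ι) (k j : ι) :
    secLin (E.coord k) (E.sec j) = (Pi.single k (oneSec X) : ι → _) j :=
  congrFun ((Equiv.ofBijective _ (E.bijective (structureModule X))).apply_symm_apply
    (Pi.single k (oneSec X))) j

lemma secLin_sum {α : Type*} {M N : X.Modules} (s : Finset α) (φ : α → (M ⟶ N)) :
    secLin (∑ k ∈ s, φ k) = ∑ k ∈ s, secLin (φ k) := by
  classical
  induction s using Finset.induction_on with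
  | empty => rw [Finset.sum_empty, Finset.sum_empty]; rfl
  | insert a s ha ih => rw [Finset.sum_insert ha, Finset.sum_insert ha, secLin_add, ih]

variable [Fintype ι]

/-- Both sides agree on the sections of the frame, and the universal property with target `M` itself
then forces equality. -/
lemma Frame.sum_coord {M : X.Modules} (E : Frame M ι) :
    ∑ k, E.coord k ≫ mulSec (E.sec k) = 𝟙 M := by
  apply (E.bijective M).1
  funext j
  simp only [secLin_sum, LinearMap.sum_apply, secLin_comp, LinearMap.comp_apply, E.coord_sec,
    secLin_id, LinearMap.id_apply]
  rw [Finset.sum_eq_single j]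
  · rw [Pi.single_eq_same, secLin_mulSec_oneSec]
  · intro k _ hk
    rw [Pi.single_eq_of_ne hk.symm, map_zero]
  · intro h
    exact absurd (Finset.mem_univ j) h

/-- The coordinates of global sections with respect to a frame. -/
def Frame.equivFun {M : X.Modules} (E : Frame M ι) : Γ(M, ⊤) ≃ₗ[Γ(X, ⊤)] (ι → Γ(X, ⊤)) where
  toFun x k := structureSec X (secLin (E.coord k) x)
  map_add' x y := by funext k; simp only [map_add, Pi.add_apply]
  map_smul' a x := by
    funext k
    simp only [map_smul, Pi.smul_apply, RingHom.id_apply]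
  invFun a := ∑ k, a k • E.sec k
  left_inv x := by
    have := congrArg (fun φ => secLin φ x) E.sum_coord
    simp only [secLin_sum, LinearMap.sum_apply, secLin_comp, LinearMap.comp_apply,
      secLin_mulSec, secLin_id, LinearMap.id_apply] at this
    exact this
  right_inv a := by
    funext k
    simp only [map_sum, map_smul, E.coord_sec]
    rw [Finset.sum_eq_single k]
    · rw [Pi.single_eq_same, structureSec_oneSec, smul_eq_mul, mul_one]
    · intro j _ hj
      rw [Pi.single_eq_of_ne hj, map_zero, smul_zero]
    · intro h
      exact absurd (Finset.mem_univ k) h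

/-- The basis of global sections given by a frame. -/
def Frame.basis {M : X.Modules} (E : Frame M ι) : Module.Basis ι Γ(X, ⊤) Γ(M, ⊤) :=
  .ofEquivFun E.equivFun

lemma Frame.basis_apply {M : X.Modules} (E : Frame M ι) (j : ι) : E.basis j = E.sec j := by
  rw [Frame.basis, Module.Basis.coe_ofEquivFun]
  change ∑ k, (Pi.single j 1 : ι → Γ(X, ⊤)) k • E.sec k = E.sec j
  rw [Finset.sum_eq_single j]
  · rw [Pi.single_eq_same, one_smul]
  · intro k _ hk
    rw [Pi.single_eq_of_ne hk, zero_smul]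
  · intro h
    exact absurd (Finset.mem_univ j) h

/-- The sections of a frame are also a basis of `Γ(M, ⊤)`, so sheaf homomorphisms and linear maps on
global sections are both given by arbitrary values on the frame. No affineness of `X` is needed. -/
lemma Frame.secLin_bijective {M : X.Modules} (E : Frame M ι) (N : X.Modules) :
    Function.Bijective fun φ : M ⟶ N => secLin φ := by
  constructor
  · intro φ ψ h
    apply (E.bijective N).1
    funext j
    exact congrArg (fun l => l (E.sec j)) h
  · intro l
    obtain ⟨φ, hφ⟩ := (E.bijective N).2 fun j => l (E.sec j)
    refine ⟨φ, E.basis.ext fun j => ?_⟩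
    rw [E.basis_apply]
    exact congrFun hφ j

variable [Fintype κ] [DecidableEq κ]

/-- The matrix of a homomorphism with respect to two frames. -/
def homMatrix {M N : X.Modules} (E : Frame M ι) (E' : Frame N κ) :
    (M ⟶ N) ≃ₗ[Γ(X, ⊤)] Matrix κ ι Γ(X, ⊤) :=
  (LinearEquiv.ofBijective
    { toFun := fun φ : M ⟶ N => secLin φ
      map_add' := secLin_add
      map_smul' := secLin_smul } (E.secLin_bijective N)).trans
    (LinearMap.toMatrix E.basis E'.basis)

lemma homMatrix_apply {M N : X.Modules} (E : Frame M ι) (E' : Frame N κ) (φ : M ⟶ N) :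
    homMatrix E E' φ = LinearMap.toMatrix E.basis E'.basis (secLin φ) := rfl

lemma secLin_sec {M N : X.Modules} (E : Frame M ι) (E' : Frame N κ) (φ : M ⟶ N) (j : ι) :
    secLin φ (E.sec j) = ∑ k, homMatrix E E' φ k j • E'.sec k := by
  rw [homMatrix_apply, ← E.basis_apply]
  simp only [LinearMap.toMatrix_apply, ← E'.basis_apply]
  exact (E'.basis.sum_repr _).symm

lemma homMatrix_eq_of_sec {M N : X.Modules} (E : Frame M ι) (E' : Frame N κ) (φ : M ⟶ N)
    (A : Matrix κ ι Γ(X, ⊤)) (h : ∀ j, secLin φ (E.sec j) = ∑ k, A k j • E'.sec k) :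
    homMatrix E E' φ = A := by
  ext k j
  rw [homMatrix_apply, LinearMap.toMatrix_apply, E.basis_apply, h]
  simp only [← E'.basis_apply, map_sum, map_smul, Module.Basis.repr_self]
  rw [Finset.sum_apply', Finset.sum_eq_single k]
  · simp
  · intro i _ hi
    simp [Finsupp.single_eq_of_ne hi.symm]
  · intro h
    exact absurd (Finset.mem_univ k) h

lemma homMatrix_comp {μ : Type*} [Fintype μ] [DecidableEq μ] {M N P : X.Modules} (E : Frame M ι)
    (E' : Frame N κ) (E'' : Frame P μ) (φ : M ⟶ N) (ψ : N ⟶ P) :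
    homMatrix E E'' (φ ≫ ψ) = homMatrix E' E'' ψ * homMatrix E E' φ := by
  rw [homMatrix_apply, secLin_comp, LinearMap.toMatrix_comp E.basis E'.basis E''.basis]
  rfl

lemma homMatrix_id {M : X.Modules} (E : Frame M ι) : homMatrix E E (𝟙 M) = 1 := by
  rw [homMatrix_apply, secLin_id, LinearMap.toMatrix_id]

/-- Pullback of sections is semilinear over `v.appTop` and commutes with restricted homomorphisms,
so expansions in the frames pull back term by term. -/
lemma homMatrix_resHom (v : Z ⟶ Y) (f : Y ⟶ X) (g : Z ⟶ X) (h : v ≫ f = g) {M N : X.Modules}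
    (E : Frame ((Scheme.Modules.pullback f).obj M) ι)
    (E' : Frame ((Scheme.Modules.pullback f).obj N) κ)
    (φ : (Scheme.Modules.pullback f).obj M ⟶ (Scheme.Modules.pullback f).obj N) :
    homMatrix (E.pull v f g h) (E'.pull v f g h) (resHom v f g h φ) =
      (homMatrix E E' φ).map v.appTop := by
  apply homMatrix_eq_of_sec
  intro j
  rw [Frame.pull_sec, resHom_pullTop, secLin_sec E E']
  generalize homMatrix E E' φ = A
  simp only [Frame.pull_sec, Matrix.map_apply, ← pullTop_smul]
  let l : Γ((Scheme.Modules.pullback f).obj N, ⊤) →+ Γ((Scheme.Modules.pullback g).obj N, ⊤) :=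
    AddMonoidHom.mk' (pullTop v f g h) (pullTop_add v f g h)
  exact map_sum l _ _

lemma resHom_map (v : Z ⟶ Y) (f : Y ⟶ X) (g : Z ⟶ X) (h : v ≫ f = g) {M N : X.Modules}
    (α : M ⟶ N) :
    resHom v f g h ((Scheme.Modules.pullback f).map α) = (Scheme.Modules.pullback g).map α := by
  rw [← cancel_epi (pullbackTo v f g h M), pullbackTo_resHom, pullbackTo_naturality]

lemma homMatrix_map (v : Z ⟶ Y) (f : Y ⟶ X) (g : Z ⟶ X) (h : v ≫ f = g) {M N : X.Modules}
    (E : Frame ((Scheme.Modules.pullback f).obj M) ι)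
    (E' : Frame ((Scheme.Modules.pullback f).obj N) κ) (α : M ⟶ N) :
    homMatrix (E.pull v f g h) (E'.pull v f g h) ((Scheme.Modules.pullback g).map α) =
      (homMatrix E E' ((Scheme.Modules.pullback f).map α)).map v.appTop := by
  rw [← homMatrix_resHom, resHom_map]

end Frames

/-! ### Gluing homomorphisms of pulled back modules along open covers -/

section Gluing

variable {X Y Z W : Scheme.{u}}

/-- Restriction of sections to a smaller open. -/
def res {M : X.Modules} {U V : X.Opens} (h : U ≤ V) (x : Γ(M, V)) : Γ(M, U) :=
  M.presheaf.map (homOfLE h).op x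

lemma res_add {M : X.Modules} {U V : X.Opens} (h : U ≤ V) (x y : Γ(M, V)) :
    res h (x + y) = res h x + res h y := map_add _ _ _

lemma res_smul {M : X.Modules} {U V : X.Opens} (h : U ≤ V) (a : Γ(X, V)) (x : Γ(M, V)) :
    res h (a • x) = (X.presheaf.map (homOfLE h).op a : Γ(X, U)) • res h x :=
  Scheme.Modules.map_smul M (homOfLE h) a x

lemma res_res {M : X.Modules} {U V W : X.Opens} (h : U ≤ V) (h' : V ≤ W) (x : Γ(M, W)) :
    res h (res h' x) = res (h.trans h') x := by
  have e : (homOfLE (h.trans h')).op = (homOfLE h').op ≫ (homOfLE h).op := rfl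
  rw [res, res, res, e, Functor.map_comp]
  rfl

lemma app_res {M N : X.Modules} (φ : M ⟶ N) {U V : X.Opens} (h : U ≤ V) (x : Γ(M, V)) :
    φ.app U (res h x) = res h (φ.app V x) :=
  hom_naturality φ (homOfLE h) x

lemma pullSec_res' (v : Z ⟶ Y) (f : Y ⟶ X) (g : Z ⟶ X) (h : v ≫ f = g) {M : X.Modules}
    {U V : Y.Opens} (i : U ≤ V) (i' : v ⁻¹ᵁ U ≤ v ⁻¹ᵁ V)
    (x : Γ((Scheme.Modules.pullback f).obj M, V)) :
    pullSec v f g h U (res i x) = res i' (pullSec v f g h V x) :=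
  pullSec_res v f g h (homOfLE i) (homOfLE i') x

lemma eq_of_res {M : X.Modules} {ι : Type*} {V : X.Opens} (U : ι → X.Opens) (hU : ∀ i, U i ≤ V)
    (hV : V ≤ iSup U) (x y : Γ(M, V)) (h : ∀ i, res (hU i) x = res (hU i) y) : x = y :=
  TopCat.Sheaf.eq_of_locally_eq' ⟨M.presheaf, M.isSheaf⟩ U V (fun i => homOfLE (hU i)) hV x y h

lemma exists_glue {M : X.Modules} {ι : Type*} {V : X.Opens} (U : ι → X.Opens) (hU : ∀ i, U i ≤ V)
    (hV : V ≤ iSup U) (s : ∀ i, Γ(M, U i))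
    (h : ∀ i j, res (inf_le_left : U i ⊓ U j ≤ U i) (s i) =
      res (inf_le_right : U i ⊓ U j ≤ U j) (s j)) : ∃ x : Γ(M, V), ∀ i, res (hU i) x = s i :=
  (TopCat.Sheaf.existsUnique_gluing' ⟨M.presheaf, M.isSheaf⟩ U V (fun i => homOfLE (hU i)) hV s
    h).exists

/-- Restriction and pullback along `v` are both left adjoint to pushforward, and uniqueness of left
adjoints matches their units. -/
lemma adjUnit_eq_of_isOpenImmersion (v : Z ⟶ Y) [IsOpenImmersion v] (M : Y.Modules) :
    adjUnit v M = (Scheme.Modules.restrictAdjunction v).unit.app M ≫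
      (Scheme.Modules.pushforward v).map
        ((Scheme.Modules.restrictFunctorIsoPullback v).hom.app M) :=
  (Adjunction.unit_leftAdjointUniq_hom_app (Scheme.Modules.restrictAdjunction v)
    (Scheme.Modules.pullbackPushforwardAdjunction v) M).symm

/-- Up to isomorphism the unit over `V` is restriction from `V` to its intersection with the image
of `v`, which is `V` itself here. -/
lemma adjUnit_app_isIso (v : Z ⟶ Y) [IsOpenImmersion v] (M : Y.Modules) {V : Y.Opens}
    (hV : V ≤ v.opensRange) : IsIso ((adjUnit v M).app V) := by
  rw [adjUnit_eq_of_isOpenImmersion, Scheme.Modules.Hom.comp_app,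
    Scheme.Modules.restrictAdjunction_unit_app_app, Scheme.Modules.pushforward_map_app]
  have e : v ''ᵁ v ⁻¹ᵁ V = V := by
    rw [Scheme.Hom.image_preimage_eq_opensRange_inf, inf_eq_right.2 hV]
  have : IsIso (homOfLE (v.image_preimage_le V)) := by
    rw [show homOfLE (v.image_preimage_le V) = eqToHom e from Subsingleton.elim _ _]
    infer_instance
  have h₁ : IsIso (M.presheaf.map (homOfLE (v.image_preimage_le V)).op) := inferInstance
  have h₂ : IsIso ((Scheme.Modules.restrictFunctorIsoPullback v).hom.app M) := inferInstance
  have h₃ := Scheme.Modules.Hom.isIso_iff_isIso_app.mp h₂ (v ⁻¹ᵁ V)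
  exact IsIso.comp_isIso' h₁ h₃

lemma unitSec_bijective (v : Z ⟶ Y) [IsOpenImmersion v] (M : Y.Modules) {V : Y.Opens}
    (hV : V ≤ v.opensRange) : Function.Bijective (unitSec v (M := M) V) := by
  have := adjUnit_app_isIso v M hV
  exact ConcreteCategory.bijective_of_isIso ((adjUnit v M).app V)

lemma pullSec_bijective (v : Z ⟶ Y) [IsOpenImmersion v] (f : Y ⟶ X) (g : Z ⟶ X) (h : v ≫ f = g)
    {M : X.Modules} {V : Y.Opens} (hV : V ≤ v.opensRange) :
    Function.Bijective (pullSec v f g h (M := M) V) := by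
  have h1 := ConcreteCategory.bijective_of_isIso ((pullbackTo v f g h M).app (v ⁻¹ᵁ V))
  have h2 := h1.comp (unitSec_bijective v ((Scheme.Modules.pullback f).obj M) hV)
  rw [funext (pullSec_def v f g h (M := M) V)]
  exact h2

section

variable (v : Z ⟶ Y) [IsOpenImmersion v] (f : Y ⟶ X) (g : Z ⟶ X) (h : v ≫ f = g)
  {M N : X.Modules}
  (φ : (Scheme.Modules.pullback g).obj M ⟶ (Scheme.Modules.pullback g).obj N)

/-- The action of a homomorphism over `Z` on sections over an open of `Y` contained in the
image of the open immersion `v : Z → Y`. -/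
def act {V : Y.Opens} (hV : V ≤ v.opensRange) (x : Γ((Scheme.Modules.pullback f).obj M, V)) :
    Γ((Scheme.Modules.pullback f).obj N, V) :=
  ((pullSec_bijective v f g h (M := N) hV).2 (φ.app _ (pullSec v f g h V x))).choose

lemma pullSec_act {V : Y.Opens} (hV : V ≤ v.opensRange)
    (x : Γ((Scheme.Modules.pullback f).obj M, V)) :
    pullSec v f g h V (act v f g h φ hV x) = φ.app _ (pullSec v f g h V x) :=
  ((pullSec_bijective v f g h (M := N) hV).2 (φ.app _ (pullSec v f g h V x))).choose_spec

lemma act_add {V : Y.Opens} (hV : V ≤ v.opensRange)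
    (x y : Γ((Scheme.Modules.pullback f).obj M, V)) :
    act v f g h φ hV (x + y) = act v f g h φ hV x + act v f g h φ hV y := by
  apply (pullSec_bijective v f g h (M := N) hV).1
  rw [pullSec_act, pullSec_add, pullSec_add, map_add, pullSec_act, pullSec_act]

lemma act_smul {V : Y.Opens} (hV : V ≤ v.opensRange) (a : Γ(Y, V))
    (x : Γ((Scheme.Modules.pullback f).obj M, V)) :
    act v f g h φ hV (a • x) = a • act v f g h φ hV x := by
  apply (pullSec_bijective v f g h (M := N) hV).1
  rw [pullSec_act, pullSec_smul, pullSec_smul, Scheme.Modules.Hom.app_smul, pullSec_act]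

lemma act_res {U V : Y.Opens} (hV : V ≤ v.opensRange) (i : U ≤ V)
    (x : Γ((Scheme.Modules.pullback f).obj M, V)) :
    act v f g h φ (i.trans hV) (res i x) = res i (act v f g h φ hV x) := by
  have i' : v ⁻¹ᵁ U ≤ v ⁻¹ᵁ V := fun _ hx => i hx
  apply (pullSec_bijective v f g h (M := N) (i.trans hV)).1
  rw [pullSec_act, pullSec_res' v f g h i i', pullSec_res' v f g h i i', app_res, pullSec_act]

lemma act_resHom (ψ : (Scheme.Modules.pullback f).obj M ⟶ (Scheme.Modules.pullback f).obj N)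
    {V : Y.Opens} (hV : V ≤ v.opensRange) (x : Γ((Scheme.Modules.pullback f).obj M, V)) :
    act v f g h (resHom v f g h ψ) hV x = ψ.app V x := by
  apply (pullSec_bijective v f g h (M := N) hV).1
  rw [pullSec_act, resHom_pullSec]

lemma act_comp (w : W ⟶ Z) [IsOpenImmersion w] (k : W ⟶ X) (h' : w ≫ g = k)
    (h'' : (w ≫ v) ≫ f = k) {V : Y.Opens} (hV : V ≤ v.opensRange) (hV' : V ≤ (w ≫ v).opensRange)
    (x : Γ((Scheme.Modules.pullback f).obj M, V)) :
    act (w ≫ v) f k h'' (resHom w g k h' φ) hV' x = act v f g h φ hV x := by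
  apply (pullSec_bijective (w ≫ v) f k h'' (M := N) hV').1
  rw [pullSec_act, ← pullSec_comp v f g h w k h' h'', ← pullSec_comp v f g h w k h' h'',
    pullSec_act]
  exact resHom_pullSec (V := v ⁻¹ᵁ V) w g k h' φ (pullSec v f g h V x)

lemma act_congr {v v' : Z ⟶ Y} [IsOpenImmersion v] [IsOpenImmersion v'] (e : v = v')
    (h : v ≫ f = g) (h' : v' ≫ f = g) {V : Y.Opens} (hV : V ≤ v.opensRange)
    (hV' : V ≤ v'.opensRange) (x : Γ((Scheme.Modules.pullback f).obj M, V)) :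
    act v f g h φ hV x = act v' f g h' φ hV' x := by
  subst e
  rfl

end

section

variable {J : Type*} {Z : J → Scheme.{u}} (v : ∀ j, Z j ⟶ Y) [∀ j, IsOpenImmersion (v j)]
  (hv : ⨆ j, (v j).opensRange = ⊤) (f : Y ⟶ X) (g : ∀ j, Z j ⟶ X) (h : ∀ j, v j ≫ f = g j)
  {M N : X.Modules}

include hv in
/-- Homomorphisms that agree on an open cover are equal. -/
lemma eq_of_resHom (φ ψ : (Scheme.Modules.pullback f).obj M ⟶ (Scheme.Modules.pullback f).obj N)
    (e : ∀ j, resHom (v j) f (g j) (h j) φ = resHom (v j) f (g j) (h j) ψ) : φ = ψ := by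
  ext V x
  refine eq_of_res (fun j => V ⊓ (v j).opensRange) (fun j => inf_le_left) ?_ _ _ fun j => ?_
  · rw [← inf_iSup_eq, hv, inf_top_eq]
  · rw [← app_res, ← app_res, ← act_resHom (v j) f (g j) (h j) φ inf_le_right, e,
      act_resHom (v j) f (g j) (h j) ψ inf_le_right]

variable (φ : ∀ j, (Scheme.Modules.pullback (g j)).obj M ⟶ (Scheme.Modules.pullback (g j)).obj N)
  (hφ : ∀ i j, resHom (pullback.fst (v i) (v j)) (g i) (pullback.fst (v i) (v j) ≫ g i) rfl (φ i) =
    resHom (pullback.snd (v i) (v j)) (g j) (pullback.fst (v i) (v j) ≫ g i)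
      (by rw [← h i, ← h j, pullback.condition_assoc]) (φ j))

include hφ in
-- `V` lies in the image of the fibre product of `Z i` and `Z j`, and by `act_comp` both actions are
-- that of the common restriction to this fibre product.
lemma act_eq_act (i j : J) {V : Y.Opens} (hi : V ≤ (v i).opensRange) (hj : V ≤ (v j).opensRange)
    (x : Γ((Scheme.Modules.pullback f).obj M, V)) :
    act (v i) f (g i) (h i) (φ i) hi x = act (v j) f (g j) (h j) (φ j) hj x := by
  have hV : V ≤ (pullback.fst (v i) (v j) ≫ v i).opensRange := by
    intro y hy
    have := IsOpenImmersion.range_pullback_to_base_of_left (v i) (v j)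
    change y ∈ Set.range (pullback.fst (v i) (v j) ≫ v i)
    rw [this]
    exact ⟨hi hy, hj hy⟩
  have e₁ : (pullback.fst (v i) (v j) ≫ v i) ≫ f = pullback.fst (v i) (v j) ≫ g i := by
    rw [← h i, Category.assoc]
  rw [← act_comp (v i) f (g i) (h i) (φ i) (pullback.fst (v i) (v j)) _ rfl e₁ hi hV, hφ i j]
  have hV' : V ≤ (pullback.snd (v i) (v j) ≫ v j).opensRange := by
    intro y hy
    have := hV hy
    change y ∈ Set.range (pullback.fst (v i) (v j) ≫ v i) at this
    rwa [pullback.condition] at this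
  have e₂ : (pullback.snd (v i) (v j) ≫ v j) ≫ f = pullback.fst (v i) (v j) ≫ g i := by
    rw [← pullback.condition, e₁]
  rw [← act_comp (v j) f (g j) (h j) (φ j) (pullback.snd (v i) (v j)) _
    (by rw [← h i, ← h j, pullback.condition_assoc]) e₂ hj hV']
  exact act_congr f _ _ pullback.condition _ _ _ _ x

include hv hφ in
-- The local actions agree on overlaps and glue by the sheaf property of the target. Prescribing `y`
-- on every open inside some member of the cover makes the later checks of additivity, linearity and
-- naturality uniform.
lemma exists_glue_act (V : Y.Opens) (x : Γ((Scheme.Modules.pullback f).obj M, V)) :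
    ∃ y : Γ((Scheme.Modules.pullback f).obj N, V), ∀ (j : J) (U : Y.Opens) (hU : U ≤ V)
      (hj : U ≤ (v j).opensRange),
      res hU y = act (v j) f (g j) (h j) (φ j) hj (res hU x) := by
  have hV : V ≤ ⨆ j, V ⊓ (v j).opensRange := by rw [← inf_iSup_eq, hv, inf_top_eq]
  obtain ⟨y, hy⟩ := exists_glue (fun j => V ⊓ (v j).opensRange) (fun j => inf_le_left) hV
    (fun j => act (v j) f (g j) (h j) (φ j) inf_le_right (res inf_le_left x)) (by
      intro i j
      rw [← act_res, ← act_res, res_res, res_res]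
      exact act_eq_act v f g h φ hφ i j _ _ _)
  refine ⟨y, fun j U hU hj => ?_⟩
  rw [← res_res (le_inf hU hj) inf_le_left, hy, ← act_res, res_res]

/-- The homomorphism glued from compatible homomorphisms on an open cover, on sections. -/
def glueFun (V : Y.Opens) (x : Γ((Scheme.Modules.pullback f).obj M, V)) :
    Γ((Scheme.Modules.pullback f).obj N, V) :=
  (exists_glue_act v hv f g h φ hφ V x).choose

lemma res_glueFun {V : Y.Opens} (x : Γ((Scheme.Modules.pullback f).obj M, V)) (j : J)
    {U : Y.Opens} (hU : U ≤ V) (hj : U ≤ (v j).opensRange) :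
    res hU (glueFun v hv f g h φ hφ V x) = act (v j) f (g j) (h j) (φ j) hj (res hU x) :=
  (exists_glue_act v hv f g h φ hφ V x).choose_spec j U hU hj

include hv in
lemma eq_of_res_cover {M : Y.Modules} {V : Y.Opens} (x y : Γ(M, V))
    (e : ∀ (j : J) (U : Y.Opens) (hU : U ≤ V), U ≤ (v j).opensRange → res hU x = res hU y) :
    x = y :=
  eq_of_res (fun j => V ⊓ (v j).opensRange) (fun _ => inf_le_left)
    (by rw [← inf_iSup_eq, hv, inf_top_eq]) _ _ fun j => e j _ _ inf_le_right

lemma glueFun_add {V : Y.Opens} (x y : Γ((Scheme.Modules.pullback f).obj M, V)) :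
    glueFun v hv f g h φ hφ V (x + y) =
      glueFun v hv f g h φ hφ V x + glueFun v hv f g h φ hφ V y := by
  refine eq_of_res_cover v hv _ _ fun j U hU hj => ?_
  rw [res_add, res_glueFun (hj := hj), res_glueFun (hj := hj), res_glueFun (hj := hj), res_add,
    act_add]

lemma glueFun_smul {V : Y.Opens} (a : Γ(Y, V)) (x : Γ((Scheme.Modules.pullback f).obj M, V)) :
    glueFun v hv f g h φ hφ V (a • x) = a • glueFun v hv f g h φ hφ V x := by
  refine eq_of_res_cover v hv _ _ fun j U hU hj => ?_
  rw [res_smul, res_glueFun (hj := hj), res_glueFun (hj := hj), res_smul, act_smul]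

lemma glueFun_res {V V' : Y.Opens} (i : V' ≤ V) (x : Γ((Scheme.Modules.pullback f).obj M, V)) :
    glueFun v hv f g h φ hφ V' (res i x) = res i (glueFun v hv f g h φ hφ V x) := by
  refine eq_of_res_cover v hv _ _ fun j U hU hj => ?_
  rw [res_res, res_glueFun (hj := hj), res_glueFun (hj := hj), res_res]

/-- The homomorphism glued from compatible homomorphisms on an open cover. -/
def glueHom : (Scheme.Modules.pullback f).obj M ⟶ (Scheme.Modules.pullback f).obj N where
  val := PresheafOfModules.homMk
    { app := fun U => AddCommGrpCat.ofHom
        (AddMonoidHom.mk' (glueFun v hv f g h φ hφ U.unop) (glueFun_add v hv f g h φ hφ))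
      naturality := fun U V i => by
        ext x
        exact glueFun_res v hv f g h φ hφ i.unop.le x }
    (fun U r x => glueFun_smul v hv f g h φ hφ r x)

lemma glueHom_app (V : Y.Opens) (x : Γ((Scheme.Modules.pullback f).obj M, V)) :
    (glueHom v hv f g h φ hφ).app V x = glueFun v hv f g h φ hφ V x := rfl

lemma resHom_glueHom (j : J) :
    resHom (v j) f (g j) (h j) (glueHom v hv f g h φ hφ) = φ j := by
  ext W z
  -- Every open of `Z j` is the preimage of its image, so every section over it is the pullback of a
  -- section on `Y`.
  obtain ⟨V, hV, rfl⟩ : ∃ V : Y.Opens, V ≤ (v j).opensRange ∧ v j ⁻¹ᵁ V = W :=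
    ⟨v j ''ᵁ W, (v j).image_le_opensRange W, (v j).preimage_image_eq W⟩
  obtain ⟨x, rfl⟩ := (pullSec_bijective (v j) f (g j) (h j) (M := M) hV).2 z
  rw [resHom_pullSec, glueHom_app, ← pullSec_act (v j) f (g j) (h j) (φ j) hV]
  congr 1
  refine eq_of_res_cover v hv _ _ fun i U hU hi => ?_
  rw [res_glueFun (j := j) (hj := hU.trans hV), act_res]

end

end Gluing

/-! ### Linked families of matrices over a commutative ring -/

section MatrixChains

variable {R R' : Type*} [CommRing R] [CommRing R'] {ι κ : Type*} [Fintype ι] [DecidableEq ι]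
  [Fintype κ] [DecidableEq κ]

/-- The composite of the maps `d j` for `j < i`, from the `i`-th module of a chain to the first. -/
def downProd (d : ℕ → Matrix κ κ R) : ℕ → Matrix κ κ R
  | 0 => 1
  | i + 1 => downProd d i * d i

/-- The composite of the `k` maps `u j` for `i ≤ j < i + k`. -/
def upProd (u : ℕ → Matrix κ κ R) : ℕ → ℕ → Matrix κ κ R
  | 0, _ => 1
  | k + 1, i => upProd u k (i + 1) * u i

lemma map_downProd (f : R →+* R') (d : ℕ → Matrix κ κ R) (i : ℕ) :
    (downProd d i).map f = downProd (fun j => (d j).map f) i := by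
  induction i with
  | zero => simp [downProd]
  | succ i ih => rw [downProd, downProd, Matrix.map_mul, ih]

lemma map_upProd (f : R →+* R') (u : ℕ → Matrix κ κ R) (k i : ℕ) :
    (upProd u k i).map f = upProd (fun j => (u j).map f) k i := by
  induction k generalizing i with
  | zero => simp [upProd]
  | succ k ih => rw [upProd, upProd, Matrix.map_mul, ih]

/-- The comparison of the `i`-th module of a chain of length `n` with the outer two. -/
def theta (n : ℕ) (u d : ℕ → Matrix κ κ R) (P Q : Matrix κ κ R) (i : ℕ) : Matrix κ κ R :=
  P * downProd d i + Q * upProd u (n - 1 - i) i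

lemma map_theta (f : R →+* R') (n : ℕ) (u d : ℕ → Matrix κ κ R) (P Q : Matrix κ κ R) (i : ℕ) :
    (theta n u d P Q i).map f =
      theta n (fun j => (u j).map f) (fun j => (d j).map f) (P.map f) (Q.map f) i := by
  rw [theta, Matrix.map_add _ (map_add f), Matrix.map_mul, Matrix.map_mul, map_downProd,
    map_upProd, theta]

/-- Matrices of the maps of two chains `F` (`a` up, `b` down) and `G` (`u` up, `d` down), for which
all composites of opposite neighbours are `s`, together with matrices `P` and `Q` on the outer
modules of `G` that jointly identify every module of `G` with a fixed one. -/
structure Splitting (n : ℕ) (s : R) (a b : ℕ → Matrix ι ι R) (u d : ℕ → Matrix κ κ R)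
    (P Q E : Matrix κ κ R) : Prop where
  ba : ∀ i, i + 1 < n → b i * a i = s • 1
  ab : ∀ i, i + 1 < n → a i * b i = s • 1
  du : ∀ i, i + 1 < n → d i * u i = s • 1
  ud : ∀ i, i + 1 < n → u i * d i = s • 1
  EE : E * E = E
  EP : E * P = P
  EQ : E * Q = 0
  isUnit : ∀ i < n, IsUnit (theta n u d P Q i)

variable {n : ℕ} {s : R} {a b : ℕ → Matrix ι ι R} {u d : ℕ → Matrix κ κ R} {P Q E : Matrix κ κ R}

omit [Fintype κ] in
lemma map_smul_one (f : R →+* R') (s : R) :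
    (s • (1 : Matrix κ κ R)).map f = f s • (1 : Matrix κ κ R') := by
  ext i j
  by_cases h : i = j <;> simp [h]

lemma Splitting.map (h : Splitting n s a b u d P Q E) (f : R →+* R') :
    Splitting n (f s) (fun i => (a i).map f) (fun i => (b i).map f) (fun i => (u i).map f)
      (fun i => (d i).map f) (P.map f) (Q.map f) (E.map f) where
  ba i hi := by rw [← Matrix.map_mul, h.ba i hi, map_smul_one]
  ab i hi := by rw [← Matrix.map_mul, h.ab i hi, map_smul_one]
  du i hi := by rw [← Matrix.map_mul, h.du i hi, map_smul_one]
  ud i hi := by rw [← Matrix.map_mul, h.ud i hi, map_smul_one]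
  EE := by rw [← Matrix.map_mul, h.EE]
  EP := by rw [← Matrix.map_mul, h.EP]
  EQ := by rw [← Matrix.map_mul, h.EQ, Matrix.map_zero _ (map_zero f)]
  isUnit i hi := by
    rw [← map_theta]
    exact (h.isUnit i hi).map f.mapMatrix

/-- Families of matrices that commute with the maps of two chains. -/
def IsLinked (n : ℕ) (a b : ℕ → Matrix ι ι R) (u d : ℕ → Matrix κ κ R)
    (Φ : Fin n → Matrix κ ι R) : Prop :=
  ∀ (i : ℕ) (hi : i + 1 < n),
    Φ ⟨i + 1, hi⟩ * a i = u i * Φ ⟨i, Nat.lt_of_succ_lt hi⟩ ∧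
    Φ ⟨i, Nat.lt_of_succ_lt hi⟩ * b i = d i * Φ ⟨i + 1, hi⟩

lemma IsLinked.downProd_mul {Φ : Fin n → Matrix κ ι R} (h : IsLinked n a b u d Φ) (i : ℕ)
    (hi : i < n) : downProd d i * Φ ⟨i, hi⟩ = Φ ⟨0, by omega⟩ * downProd b i := by
  induction i with
  | zero => simp [downProd]
  | succ i ih =>
    rw [downProd, downProd, Matrix.mul_assoc, ← (h i hi).2, ← Matrix.mul_assoc, ih,
      Matrix.mul_assoc]

lemma IsLinked.upProd_mul {Φ : Fin n → Matrix κ ι R} (h : IsLinked n a b u d Φ) (k i : ℕ)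
    (hi : i + k < n) :
    upProd u k i * Φ ⟨i, by omega⟩ = Φ ⟨i + k, hi⟩ * upProd a k i := by
  induction k generalizing i with
  | zero => simp [upProd]
  | succ k ih =>
    have := ih (i + 1) (by omega)
    rw [upProd, upProd, Matrix.mul_assoc, ← (h i (by omega)).1, ← Matrix.mul_assoc, this,
      Matrix.mul_assoc]
    congr 2
    exact Fin.ext (show i + 1 + k = i + (k + 1) by omega)

lemma downProd_succ_mul (hdu : d n * u n = s • 1) : downProd d (n + 1) * u n = s • downProd d n := by
  rw [downProd, mul_assoc, hdu, Matrix.mul_smul, mul_one]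

lemma upProd_succ_mul {k i : ℕ} (hud : u i * d i = s • 1) :
    upProd u (k + 1) i * d i = s • upProd u k (i + 1) := by
  rw [upProd, mul_assoc, hud, Matrix.mul_smul, mul_one]

/-- The outer components of a linked family. -/
def outer (hn : 1 ≤ n) (P Q : Matrix κ κ R) (Φ : Fin n → Matrix κ ι R) : Matrix κ ι R :=
  P * Φ ⟨0, hn⟩ + Q * Φ ⟨n - 1, Nat.sub_one_lt_of_lt hn⟩

lemma Splitting.E_mul_theta (h : Splitting n s a b u d P Q E) (i : ℕ) :
    E * theta n u d P Q i = P * downProd d i := by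
  rw [theta, mul_add, ← mul_assoc, ← mul_assoc, h.EP, h.EQ, zero_mul, add_zero]

lemma Splitting.one_sub_E_mul_theta (h : Splitting n s a b u d P Q E) (i : ℕ) :
    (1 - E) * theta n u d P Q i = Q * upProd u (n - 1 - i) i := by
  rw [sub_mul, one_mul, h.E_mul_theta, theta, add_sub_cancel_left]

/-- A linked family slides past the composites to the ends, which leaves `P Φ_first` and `Q Φ_last`.
Multiplying the outer matrix by `E` and by `1 - E` extracts these two terms. -/
lemma Splitting.theta_mul (h : Splitting n s a b u d P Q E) (hn : 1 ≤ n)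
    {Φ : Fin n → Matrix κ ι R} (hΦ : IsLinked n a b u d Φ) (i : ℕ) (hi : i < n) :
    theta n u d P Q i * Φ ⟨i, hi⟩ = E * outer hn P Q Φ * downProd b i +
      (1 - E) * outer hn P Q Φ * upProd a (n - 1 - i) i := by
  have h₁ : E * outer hn P Q Φ = P * Φ ⟨0, hn⟩ := by
    rw [outer, Matrix.mul_add, ← Matrix.mul_assoc, ← Matrix.mul_assoc, h.EP, h.EQ,
      Matrix.zero_mul, add_zero]
  have h₂ : (1 - E) * outer hn P Q Φ = Q * Φ ⟨n - 1, Nat.sub_one_lt_of_lt hn⟩ := by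
    rw [Matrix.sub_mul, h₁, Matrix.one_mul, outer, add_sub_cancel_left]
  rw [h₁, h₂, theta, Matrix.add_mul, Matrix.mul_assoc, hΦ.downProd_mul, Matrix.mul_assoc,
    hΦ.upProd_mul (n - 1 - i) i (by omega), Matrix.mul_assoc, Matrix.mul_assoc]
  congr 4
  exact Fin.ext (show i + (n - 1 - i) = n - 1 by omega)

omit [Fintype ι] [DecidableEq ι] in
lemma mul_left_cancel_of_isUnit {A : Matrix κ κ R} (hA : IsUnit A) {B C : Matrix κ ι R}
    (h : A * B = A * C) : B = C := by
  obtain ⟨A, rfl⟩ := hA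
  have := congrArg (fun D => (↑A⁻¹ : Matrix κ κ R) * D) h
  simpa only [← Matrix.mul_assoc, Units.inv_mul, Matrix.one_mul] using this

omit [Fintype ι] [DecidableEq ι] in
lemma exists_mul_eq_of_isUnit {A : Matrix κ κ R} (hA : IsUnit A) (B : Matrix κ ι R) :
    ∃ C : Matrix κ ι R, A * C = B := by
  obtain ⟨A, rfl⟩ := hA
  refine ⟨((↑A⁻¹ : Matrix κ κ R) * B : Matrix κ ι R), ?_⟩
  rw [← Matrix.mul_assoc, Units.mul_inv, Matrix.one_mul]

/-- A linked family is determined by its outer components, which can be chosen freely. -/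
theorem Splitting.outer_bijective (h : Splitting n s a b u d P Q E) (hn : 1 ≤ n) :
    Function.Bijective fun Φ : {Φ : Fin n → Matrix κ ι R // IsLinked n a b u d Φ} =>
      outer hn P Q Φ.1 := by
  constructor
  · rintro ⟨Φ, hΦ⟩ ⟨Ψ, hΨ⟩ (e : outer hn P Q Φ = outer hn P Q Ψ)
    refine Subtype.ext (funext fun i => mul_left_cancel_of_isUnit (h.isUnit i i.2) ?_)
    exact (h.theta_mul hn hΦ i i.2).trans (by rw [e, ← h.theta_mul hn hΨ i i.2])
  · intro (C : Matrix κ ι R)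
    -- `Splitting.theta_mul` leaves no other choice for the `i`-th component.
    have hC : ∀ i : Fin n, ∃ D : Matrix κ ι R, theta n u d P Q i * D =
        E * C * downProd b i + (1 - E) * C * upProd a (n - 1 - i) i := fun i =>
      exists_mul_eq_of_isUnit (h.isUnit i i.2) _
    choose Φ hΦ using hC
    have hE : E * (1 - E) = 0 := by rw [mul_sub, mul_one, h.EE, sub_self]
    have hE' : (1 - E) * E = 0 := by rw [sub_mul, one_mul, h.EE, sub_self]
    have hE'' : (1 - E) * (1 - E) = 1 - E := by rw [mul_sub, mul_one, hE', sub_zero]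
    -- Multiplying the defining equation by `E`, and below by `1 - E`, separates its two summands.
    have h₁ : ∀ i : Fin n, P * downProd d i * Φ i = E * C * downProd b i := fun i => by
      rw [← h.E_mul_theta, Matrix.mul_assoc, hΦ, Matrix.mul_add]
      simp only [← Matrix.mul_assoc, hE, h.EE, Matrix.zero_mul, add_zero]
    have h₂ : ∀ i : Fin n, Q * upProd u (n - 1 - i) i * Φ i =
        (1 - E) * C * upProd a (n - 1 - i) i := fun i => by
      rw [← h.one_sub_E_mul_theta, Matrix.mul_assoc, hΦ, Matrix.mul_add]
      simp only [← Matrix.mul_assoc, hE', hE'', Matrix.zero_mul, zero_add]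
    have hk : ∀ i, i + 1 < n → n - 1 - i = n - 1 - (i + 1) + 1 := fun i hi => by omega
    refine ⟨⟨Φ, fun i hi => ⟨?_, ?_⟩⟩, ?_⟩
    · apply mul_left_cancel_of_isUnit (h.isUnit (i + 1) hi)
      have e₁ := h₁ ⟨i, Nat.lt_of_succ_lt hi⟩
      have e₂ := h₂ ⟨i, Nat.lt_of_succ_lt hi⟩
      have e₃ := hΦ ⟨i + 1, hi⟩
      simp only [hk i hi] at e₂
      -- `d i * u i = s` shortens the downward composite, while the upward one absorbs `u i`. On the
      -- other side `b i * a i = s` gives the same two terms.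
      have e₄ : theta n u d P Q (i + 1) * u i =
          s • (P * downProd d i) + Q * upProd u (n - 1 - (i + 1) + 1) i := by
        rw [theta, add_mul, mul_assoc, downProd_succ_mul (h.du i hi), mul_assoc, upProd,
          Matrix.mul_smul]
      rw [← Matrix.mul_assoc, e₃, ← Matrix.mul_assoc, e₄, Matrix.add_mul, Matrix.add_mul,
        Matrix.smul_mul, e₁, e₂, Matrix.mul_assoc _ (downProd b _), downProd_succ_mul (h.ba i hi),
        Matrix.mul_smul, Matrix.mul_assoc _ (upProd a _ _), upProd]
    · apply mul_left_cancel_of_isUnit (h.isUnit i (Nat.lt_of_succ_lt hi))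
      have e₁ := h₁ ⟨i + 1, hi⟩
      have e₂ := h₂ ⟨i + 1, hi⟩
      have e₃ := hΦ ⟨i, Nat.lt_of_succ_lt hi⟩
      simp only [hk i hi] at e₃
      -- The mirror image: the downward composite absorbs `d i`, and the upward one is shortened by
      -- `u i * d i = s`.
      have e₄ : theta n u d P Q i * d i =
          P * downProd d (i + 1) + s • (Q * upProd u (n - 1 - (i + 1)) (i + 1)) := by
        rw [theta, add_mul, hk i hi, mul_assoc, mul_assoc, upProd_succ_mul (h.ud i hi), downProd,
          Matrix.mul_smul]
      rw [← Matrix.mul_assoc, e₃, ← Matrix.mul_assoc, e₄, Matrix.add_mul, Matrix.add_mul,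
        Matrix.smul_mul, e₁, e₂, Matrix.mul_assoc _ (upProd a _ _), upProd_succ_mul (h.ab i hi),
        Matrix.mul_smul, Matrix.mul_assoc _ (downProd b _), downProd]
    -- At each end one of the composites is empty, so `P Φ_first = E C` and `Q Φ_last = (1 - E) C`.
    · have e₁ := h₁ ⟨0, hn⟩
      have e₂ := h₂ ⟨n - 1, Nat.sub_one_lt_of_lt hn⟩
      simp only [Nat.sub_self, downProd, upProd, Matrix.mul_one] at e₁ e₂
      change outer hn P Q Φ = C
      rw [outer, e₁, e₂, ← Matrix.add_mul, add_sub_cancel, Matrix.one_mul]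

end MatrixChains

/-! ### Existence of the splitting matrices over a field -/

section FieldChains

open scoped Matrix

variable {K : Type*} [Field K] {κ : Type*} [Fintype κ] [DecidableEq κ]

/-- Project onto `W`, identify `W` with `K ^ J` by dimension, and extend by zero. -/
lemma exists_linearMap_injOn (W : Submodule K (κ → K)) (J : Finset κ)
    (hJ : J.card = Module.finrank K W) :
    ∃ P : (κ → K) →ₗ[K] (κ → K), (∀ x ∈ W, P x = 0 → x = 0) ∧ ∀ x, ∀ j ∉ J, P x j = 0 := by
  have hd : Module.finrank K W = Module.finrank K (J → K) := by
    rw [Module.finrank_fintype_fun_eq_card, Fintype.card_coe, hJ]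
  let e := LinearEquiv.ofFinrankEq W (J → K) hd
  obtain ⟨p, hp⟩ := W.subtype.exists_leftInverse_of_injective (Submodule.ker_subtype W)
  let z : (J → K) →ₗ[K] (κ → K) :=
    LinearMap.pi fun k => if h : k ∈ J then LinearMap.proj ⟨k, h⟩ else 0
  refine ⟨z ∘ₗ e.toLinearMap ∘ₗ p, fun x hx h0 => ?_, fun x j hj => ?_⟩
  · have h₁ : p x = ⟨x, hx⟩ := LinearMap.congr_fun hp ⟨x, hx⟩
    have h₂ : e (p x) = 0 := by
      funext j
      have := congrFun h0 j.1
      simpa [z] using this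
    rw [h₁, EmbeddingLike.map_eq_zero_iff] at h₂
    exact congrArg Subtype.val h₂
  · simp [z, hj]

variable {n : ℕ} {u d : ℕ → Matrix κ κ K}

/-- By hypothesis each map is injective on the image of the map applied before it, so a composite
kills no more than the first map that is applied. -/
lemma mulVec_downProd_eq_zero
    (h : ∀ i, i + 2 < n → ∀ v, d i *ᵥ (d (i + 1) *ᵥ v) = 0 → d (i + 1) *ᵥ v = 0)
    (i : ℕ) (hi : i + 1 < n) (v : κ → K) (hv : downProd d (i + 1) *ᵥ v = 0) : d i *ᵥ v = 0 := by
  induction i generalizing v with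
  | zero => simpa [downProd] using hv
  | succ i ih =>
    rw [downProd, ← Matrix.mulVec_mulVec] at hv
    exact h i hi v (ih (Nat.lt_of_succ_lt hi) _ hv)

lemma mulVec_upProd_eq_zero
    (h : ∀ i, i + 2 < n → ∀ v, u (i + 1) *ᵥ (u i *ᵥ v) = 0 → u i *ᵥ v = 0)
    (k i : ℕ) (hi : i + k + 1 < n) (v : κ → K) (hv : upProd u (k + 1) i *ᵥ v = 0) :
    u i *ᵥ v = 0 := by
  induction k generalizing i v with
  | zero => simpa [upProd] using hv
  | succ k ih =>
    rw [upProd, ← Matrix.mulVec_mulVec] at hv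
    exact h i (by omega) v (ih (i + 1) (by omega) _ hv)

lemma downProd_mulVec_mem (i : ℕ) (v : κ → K) :
    ∃ w, downProd d (i + 1) *ᵥ v = d 0 *ᵥ w := by
  induction i generalizing v with
  | zero => exact ⟨v, by simp [downProd]⟩
  | succ i ih =>
    rw [downProd, ← Matrix.mulVec_mulVec]
    exact ih _

lemma upProd_mulVec_mem (k i : ℕ) (v : κ → K) :
    ∃ w, upProd u (k + 1) i *ᵥ v = u (i + k) *ᵥ w := by
  induction k generalizing i v with
  | zero => exact ⟨v, by simp [upProd]⟩
  | succ k ih =>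
    rw [upProd, ← Matrix.mulVec_mulVec]
    obtain ⟨w, hw⟩ := ih (i + 1) (u i *ᵥ v)
    exact ⟨w, by rw [hw, add_right_comm, add_assoc]⟩

/-- Two matrices with supports in complementary sets of rows, such that `theta` is invertible. -/
lemma exists_isUnit_theta (hn : 1 ≤ n)
    (hu : ∀ i, i + 1 < n → LinearMap.ker (u i).mulVecLin = LinearMap.range (d i).mulVecLin)
    (hd : ∀ i, i + 1 < n → LinearMap.ker (d i).mulVecLin = LinearMap.range (u i).mulVecLin)
    (hu' : ∀ i, i + 2 < n →
      IsCompl (LinearMap.range (u i).mulVecLin) (LinearMap.ker (u (i + 1)).mulVecLin))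
    (hd' : ∀ i, i + 2 < n →
      Disjoint (LinearMap.range (d (i + 1)).mulVecLin) (LinearMap.ker (d i).mulVecLin)) :
    ∃ (J : Finset κ) (P Q : Matrix κ κ K), (∀ j ∉ J, ∀ k, P j k = 0) ∧ (∀ j ∈ J, ∀ k, Q j k = 0) ∧
      ∀ i < n, IsUnit (theta n u d P Q i) := by
  -- A chain of length one has no maps, and `theta` is `P + Q`.
  rcases hn.eq_or_lt with rfl | hn
  · refine ⟨Finset.univ, 1, 0, fun j hj => absurd (Finset.mem_univ j) hj, fun _ _ _ => rfl,
      fun i hi => ?_⟩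
    obtain rfl : i = 0 := by omega
    simp [theta, downProd]
  obtain ⟨n, rfl⟩ : ∃ k, n = k + 2 := ⟨n - 2, by omega⟩
  -- The image of `u i` is complementary to the kernel of `u (i + 1)`, so its dimension is the rank
  -- of `u (i + 1)`.
  have rk : ∀ i, i + 1 < n + 2 → Module.finrank K (LinearMap.range (u i).mulVecLin) =
      Module.finrank K (LinearMap.range (u 0).mulVecLin) := by
    intro i hi
    induction i with
    | zero => rfl
    | succ i ih =>
      rw [← ih (by omega)]
      have h₁ := Submodule.finrank_add_eq_of_isCompl (hu' i hi)
      have h₂ := LinearMap.finrank_range_add_finrank_ker (u (i + 1)).mulVecLin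
      omega
  have rk' : Module.finrank K (LinearMap.range (u 0).mulVecLin) +
      Module.finrank K (LinearMap.range (d 0).mulVecLin) = Fintype.card κ := by
    rw [← hu 0 (by omega), LinearMap.finrank_range_add_finrank_ker,
      Module.finrank_fintype_fun_eq_card]
  -- Only the size of `J` matters. With length `n + 2` the last upward map is `u n`, whose rank is
  -- then the size of the complement of `J`.
  obtain ⟨J, -, hJ⟩ := Finset.exists_subset_card_eq (s := (Finset.univ : Finset κ))
    (n := Module.finrank K (LinearMap.range (d 0).mulVecLin))
    (by rw [Finset.card_univ]; omega)
  have hJ' : Jᶜ.card = Module.finrank K (LinearMap.range (u n).mulVecLin) := by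
    rw [Finset.card_compl, hJ, rk n (by omega)]
    omega
  obtain ⟨P, hP, hPJ⟩ := exists_linearMap_injOn _ J hJ
  obtain ⟨Q, hQ, hQJ⟩ := exists_linearMap_injOn _ Jᶜ hJ'
  refine ⟨J, LinearMap.toMatrix' P, LinearMap.toMatrix' Q,
    fun j hj k => by rw [LinearMap.toMatrix'_apply]; exact hPJ _ j hj,
    fun j hj k => by
      rw [LinearMap.toMatrix'_apply]
      exact hQJ _ j (by simpa using hj), fun i hi => ?_⟩
  rw [← Matrix.mulVec_injective_iff_isUnit]
  refine (injective_iff_map_eq_zero (Matrix.mulVecLin _)).2 fun v hv => ?_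
  rw [Matrix.mulVecLin_apply, theta, Matrix.add_mulVec, ← Matrix.mulVec_mulVec,
    ← Matrix.mulVec_mulVec, LinearMap.toMatrix'_mulVec, LinearMap.toMatrix'_mulVec] at hv
  -- The values of `P` and `Q` have disjoint supports, so both summands vanish.
  have hv₁ : P (downProd d i *ᵥ v) = 0 := by
    funext j
    by_cases hj : j ∈ J
    · have := congrFun hv j
      rwa [Pi.add_apply, hQJ _ j (by simpa using hj), add_zero] at this
    · exact hPJ _ j hj
  have hv₂ : Q (upProd u (n + 2 - 1 - i) i *ᵥ v) = 0 := by rwa [hv₁, zero_add] at hv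
  have hdd : ∀ i, i + 2 < n + 2 → ∀ v, d i *ᵥ (d (i + 1) *ᵥ v) = 0 → d (i + 1) *ᵥ v = 0 :=
    fun i hi v h => Submodule.disjoint_def.1 (hd' i hi) _ ⟨v, rfl⟩ h
  have huu : ∀ i, i + 2 < n + 2 → ∀ v, u (i + 1) *ᵥ (u i *ᵥ v) = 0 → u i *ᵥ v = 0 :=
    fun i hi v h => Submodule.disjoint_def.1 (hu' i hi).disjoint _ ⟨v, rfl⟩ h
  -- The downward composite has values in the image of `d 0`, where `P` is injective. So the
  -- composite kills `v`, and hence so does its first map.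
  have low : ∀ k, i = k + 1 → d k *ᵥ v = 0 := by
    rintro k rfl
    obtain ⟨w, hw⟩ := downProd_mulVec_mem (d := d) k v
    exact mulVec_downProd_eq_zero hdd k hi v (hP _ ⟨w, hw.symm⟩ hv₁)
  have high : i < n + 1 → u i *ᵥ v = 0 := by
    intro hi'
    obtain ⟨k, hk⟩ : ∃ k, n + 2 - 1 - i = k + 1 := ⟨n - i, by omega⟩
    rw [hk] at hv₂
    obtain ⟨w, hw⟩ := upProd_mulVec_mem (u := u) k i v
    obtain rfl : n = i + k := by omega
    exact mulVec_upProd_eq_zero huu k i (by omega) v (hQ _ ⟨w, hw.symm⟩ hv₂)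
  -- At the first module `v` lies in the image of `d 0`, where `P` is injective; at the last, in the
  -- image of `u n`, where `Q` is. In between, `v` lies in the image of one upward map and in the
  -- kernel of the next.
  rcases Nat.eq_zero_or_pos i with rfl | h0
  · have : v ∈ LinearMap.range (d 0).mulVecLin := hu 0 (by omega) ▸ high (by omega)
    exact hP v this (by simpa [downProd] using hv₁)
  obtain ⟨k, rfl⟩ : ∃ k, i = k + 1 := ⟨i - 1, by omega⟩
  have hk : v ∈ LinearMap.range (u k).mulVecLin := hd k hi ▸ low k rfl
  by_cases hkn : k = n
  · subst hkn
    exact hQ v hk (by simpa [upProd] using hv₂)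
  · exact Submodule.disjoint_def.1 (hu' k (by omega)).disjoint v hk (high (by omega))

end FieldChains

/-! ### Functors on `S`-schemes as functors on all schemes -/

section Total

variable {S : Scheme.{u}} (P : (Over S)ᵒᵖ ⥤ Type u)

/-- Restriction of elements of a functor on `S`-schemes along a morphism `v` over `S`. -/
def restr {W T : Scheme.{u}} (v : W ⟶ T) (f : T ⟶ S) (g : W ⟶ S) (h : v ≫ f = g)
    (a : P.obj (op (Over.mk f))) : P.obj (op (Over.mk g)) :=
  P.map (Over.homMk (U := Over.mk g) (V := Over.mk f) v h).op a

variable {P}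

lemma restr_id {T : Scheme.{u}} (f : T ⟶ S) (h : 𝟙 T ≫ f = f) (a : P.obj (op (Over.mk f))) :
    restr P (𝟙 T) f f h a = a := by
  have e : (Over.homMk (U := Over.mk f) (V := Over.mk f) (𝟙 T) h) = 𝟙 _ := rfl
  rw [restr, e, op_id, P.map_id]
  rfl

lemma restr_comp {V W T : Scheme.{u}} (w : V ⟶ W) (v : W ⟶ T) (f : T ⟶ S) (g : W ⟶ S) (k : V ⟶ S)
    (h : v ≫ f = g) (h' : w ≫ g = k) (h'' : (w ≫ v) ≫ f = k) (a : P.obj (op (Over.mk f))) :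
    restr P w g k h' (restr P v f g h a) = restr P (w ≫ v) f k h'' a := by
  have e : (Over.homMk (U := Over.mk k) (V := Over.mk f) (w ≫ v) h'') =
    Over.homMk (U := Over.mk k) (V := Over.mk g) w h' ≫
      Over.homMk (U := Over.mk g) (V := Over.mk f) v h := rfl
  rw [restr, restr, restr, e, op_comp, P.map_comp]
  rfl

variable (P)

/-- Pairs of a morphism `T ⟶ S` and an element of `P` over it. -/
structure TotalPoint (T : Scheme.{u}) : Type u where
  base : T ⟶ S
  val : P.obj (op (Over.mk base))

variable {P}

/-- Restriction along the identity replaces transport along an equality of the base morphisms. -/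
lemma TotalPoint.ext' {T : Scheme.{u}} (x y : TotalPoint P T) (h : 𝟙 T ≫ x.base = y.base)
    (e : restr P (𝟙 T) x.base y.base h x.val = y.val) : x = y := by
  obtain ⟨f, a⟩ := x
  obtain ⟨g, b⟩ := y
  obtain rfl : f = g := by simpa using h
  rw [restr_id] at e
  exact congrArg _ e

/-- Restriction of pairs. -/
def TotalPoint.res {W T : Scheme.{u}} (v : W ⟶ T) (x : TotalPoint P T) : TotalPoint P W :=
  ⟨v ≫ x.base, restr P v x.base _ rfl x.val⟩

lemma TotalPoint.res_eq {W T : Scheme.{u}} (v : W ⟶ T) (x : TotalPoint P T) (y : TotalPoint P W)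
    (h : v ≫ x.base = y.base) (e : restr P v x.base y.base h x.val = y.val) : x.res v = y := by
  refine TotalPoint.ext' _ _ ((Category.id_comp _).trans h) ?_
  refine (restr_comp _ _ _ _ _ rfl _ (by simpa using h) _).trans ?_
  rw [← e]
  simp only [Category.id_comp]

lemma TotalPoint.restr_of_res_eq {W T : Scheme.{u}} {v : W ⟶ T} {x : TotalPoint P T}
    {y : TotalPoint P W} (e : x.res v = y) (h : v ≫ x.base = y.base) :
    restr P v x.base y.base h x.val = y.val := by
  subst e
  rfl

lemma TotalPoint.base_of_res_eq {W T : Scheme.{u}} {v : W ⟶ T} {x : TotalPoint P T}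
    {y : TotalPoint P W} (e : x.res v = y) : v ≫ x.base = y.base := by
  subst e
  rfl

lemma TotalPoint.res_res {V W T : Scheme.{u}} (w : V ⟶ W) (v : W ⟶ T) (x : TotalPoint P T) :
    (x.res v).res w = x.res (w ≫ v) :=
  TotalPoint.res_eq _ _ _ (Category.assoc _ _ _).symm (restr_comp _ _ _ _ _ _ _ _ _)

variable (P)

/-- The functor on all schemes sending `T` to the set of pairs of a morphism `T ⟶ S` and an
element of `P` over it. -/
def totalFunctor : Scheme.{u}ᵒᵖ ⥤ Type u where
  obj T := TotalPoint P T.unop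
  map v := ↾fun x => x.res v.unop
  map_id T := by
    ext x
    exact TotalPoint.res_eq _ _ _ (Category.id_comp _) (restr_id _ _ _)
  map_comp v w := by
    ext x
    exact TotalPoint.res_eq _ _ _ (Category.assoc _ _ _) (restr_comp _ _ _ _ _ _ _ _ _).symm

/-- Descent of elements of `P` along open covers. -/
structure IsZariskiSheaf : Prop where
  eq_of_restr : ∀ {Y : Scheme.{u}} {J : Type (u + 1)} {Z : J → Scheme.{u}} (v : ∀ j, Z j ⟶ Y)
    [∀ j, IsOpenImmersion (v j)] (_ : ⨆ j, (v j).opensRange = ⊤) (f : Y ⟶ S) (g : ∀ j, Z j ⟶ S)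
    (h : ∀ j, v j ≫ f = g j) (a b : P.obj (op (Over.mk f))),
    (∀ j, restr P (v j) f (g j) (h j) a = restr P (v j) f (g j) (h j) b) → a = b
  exists_glue : ∀ {Y : Scheme.{u}} {J : Type (u + 1)} {Z : J → Scheme.{u}} (v : ∀ j, Z j ⟶ Y)
    [∀ j, IsOpenImmersion (v j)] (_ : ⨆ j, (v j).opensRange = ⊤) (f : Y ⟶ S) (g : ∀ j, Z j ⟶ S)
    (h : ∀ j, v j ≫ f = g j) (a : ∀ j, P.obj (op (Over.mk (g j)))),
    (∀ i j, restr P (pullback.fst (v i) (v j)) (g i) (pullback.fst (v i) (v j) ≫ g i) rfl (a i) =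
      restr P (pullback.snd (v i) (v j)) (g j) (pullback.fst (v i) (v j) ≫ g i)
        (by rw [← h i, ← h j, pullback.condition_assoc]) (a j)) →
    ∃ b, ∀ j, restr P (v j) f (g j) (h j) b = a j

variable {P}

/-- The base morphisms to `S` glue first; over the glued morphism the elements of `P` then descend.
-/
lemma isSheaf_totalFunctor (hP : IsZariskiSheaf P) :
    Presieve.IsSheaf Scheme.zariskiTopology (totalFunctor P) := by
  rw [Precoverage.isSheaf_toGrothendieck_iff_of_isStableUnderBaseChange]
  rintro Y R hR x hx
  obtain ⟨(𝓤 : Scheme.OpenCover Y), rfl⟩ := Scheme.exists_cover_of_mem_pretopology hR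
  let y : ∀ j, TotalPoint P (𝓤.X j) := fun j => x (𝓤.f j) (.mk j)
  have comp : ∀ i j, (y i).res (pullback.fst (𝓤.f i) (𝓤.f j)) =
      (y j).res (pullback.snd (𝓤.f i) (𝓤.f j)) := fun i j => hx _ _ _ _ pullback.condition
  have hv : ⨆ j, (𝓤.f j).opensRange = ⊤ := 𝓤.iSup_opensRange
  let f : Y ⟶ S := 𝓤.glueMorphisms (fun j => (y j).base) fun i j =>
    congrArg TotalPoint.base (comp i j)
  have hf : ∀ j, 𝓤.f j ≫ f = (y j).base := fun j => 𝓤.ι_glueMorphisms _ _ j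
  obtain ⟨b, hb⟩ := hP.exists_glue 𝓤.f hv f _ hf (fun j => (y j).val) fun i j => by
    exact (TotalPoint.restr_of_res_eq (comp i j).symm _).symm
  refine ⟨(⟨f, b⟩ : TotalPoint P Y), ?_, ?_⟩
  · rintro Z e ⟨j⟩
    exact TotalPoint.res_eq _ _ _ (hf j) (hb j)
  · intro z hz
    have hz' : ∀ j, TotalPoint.res (𝓤.f j) z = y j := fun j => hz (𝓤.f j) (.mk j)
    have hbase : (TotalPoint.base z : Y ⟶ S) = f := by
      refine 𝓤.hom_ext _ _ fun j => ?_
      rw [hf j]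
      exact TotalPoint.base_of_res_eq (hz' j)
    obtain ⟨f', a⟩ := z
    obtain rfl : f' = f := hbase
    refine congrArg (TotalPoint.mk f) ?_
    refine hP.eq_of_restr 𝓤.f hv f _ hf _ _ fun j => ?_
    rw [hb]
    exact TotalPoint.restr_of_res_eq (hz' j) _

end Total

/-! ### Charts as open immersions of affine spaces -/

section Charts

variable {S : Scheme.{u}} (P : (Over S)ᵒᵖ ⥤ Type u) (k : ℕ)

/-- Natural coordinates for the elements of `P` over schemes that lie over the open set `U`. -/
structure Chart (U : S.Opens) where
  equiv : ∀ {W : Scheme.{u}} (w : W ⟶ U.toScheme) (g : W ⟶ S) (_ : w ≫ U.ι = g),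
    P.obj (op (Over.mk g)) ≃ (Fin k → Γ(W, ⊤))
  natural : ∀ {W T : Scheme.{u}} (v : W ⟶ T) (t : T ⟶ U.toScheme) (w : W ⟶ U.toScheme)
    (_ : v ≫ t = w) (f : T ⟶ S) (g : W ⟶ S) (h : t ≫ U.ι = f) (h' : w ≫ U.ι = g)
    (h'' : v ≫ f = g) (a : P.obj (op (Over.mk f))) (j : Fin k),
    equiv w g h' (restr P v f g h'' a) j = v.appTop (equiv t f h a j)

variable {P k} {U : S.Opens} (c : Chart P k U)

/-- The affine space over an open subset. -/
abbrev affine (k : ℕ) (U : S.Opens) : Scheme.{u} := 𝔸(ULift.{u} (Fin k); U.toScheme)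

/-- The element of the total functor given by a morphism to the affine space. -/
def Chart.point {W : Scheme.{u}} (α : W ⟶ affine k U) : TotalPoint P W where
  base := (α ≫ affine k U ↘ U.toScheme) ≫ U.ι
  val := (c.equiv (α ≫ affine k U ↘ U.toScheme) _ rfl).symm fun j =>
    α.appTop (AffineSpace.coord U.toScheme (ULift.up j))

lemma Chart.equiv_congr {W : Scheme.{u}} (w : W ⟶ U.toScheme) (g g' : W ⟶ S) (h : w ≫ U.ι = g)
    (h' : w ≫ U.ι = g') (e : 𝟙 W ≫ g = g') (a : P.obj (op (Over.mk g))) :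
    c.equiv w g' h' (restr P (𝟙 W) g g' e a) = c.equiv w g h a := by
  subst h'
  obtain rfl := h
  rw [restr_id]

lemma Chart.equiv_point_val {W : Scheme.{u}} (α : W ⟶ affine k U)
    (h : (α ≫ affine k U ↘ U.toScheme) ≫ U.ι = (c.point α).base) (j : Fin k) :
    c.equiv _ (c.point α).base h (c.point α).val j =
      α.appTop (AffineSpace.coord U.toScheme (ULift.up j)) :=
  congrFun (Equiv.apply_symm_apply (c.equiv (α ≫ affine k U ↘ U.toScheme) _ rfl)
    (fun j => α.appTop (AffineSpace.coord U.toScheme (ULift.up j)))) j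

lemma Chart.equiv_point {W : Scheme.{u}} (α : W ⟶ affine k U) (g : W ⟶ S)
    (h : (α ≫ affine k U ↘ U.toScheme) ≫ U.ι = g) (e : 𝟙 W ≫ (c.point α).base = g) (j : Fin k) :
    c.equiv _ g h (restr P (𝟙 W) (c.point α).base g e (c.point α).val) j =
      α.appTop (AffineSpace.coord U.toScheme (ULift.up j)) := by
  have e₁ := c.equiv_congr (α ≫ affine k U ↘ U.toScheme) (c.point α).base g rfl h e (c.point α).val
  exact (congrFun e₁ j).trans (c.equiv_point_val α rfl j)

/-- A morphism to affine space is a morphism to `U` with `k` functions. The former is determined by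
the base morphism because `U.ι` is a monomorphism, the latter are the coordinates in the chart. -/
lemma Chart.point_eq_iff {W : Scheme.{u}} (α : W ⟶ affine k U) (w : W ⟶ U.toScheme)
    (x : TotalPoint P W) (h : w ≫ U.ι = x.base) :
    c.point α = x ↔ α ≫ affine k U ↘ U.toScheme = w ∧
      ∀ j, α.appTop (AffineSpace.coord U.toScheme (ULift.up j)) = c.equiv w x.base h x.val j := by
  constructor
  · rintro rfl
    obtain rfl : w = α ≫ affine k U ↘ U.toScheme := (cancel_mono U.ι).1 h
    exact ⟨rfl, fun j => (c.equiv_point_val α h j).symm⟩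
  · rintro ⟨rfl, e⟩
    refine TotalPoint.ext' _ _ ((Category.id_comp _).trans h) ?_
    apply (c.equiv _ x.base h).injective
    funext j
    exact (c.equiv_point α x.base h _ j).trans (e j)

lemma Chart.point_homOfVector {W : Scheme.{u}} (w : W ⟶ U.toScheme)
    (x : TotalPoint P W) (h : w ≫ U.ι = x.base) :
    c.point (AffineSpace.homOfVector w fun j => c.equiv w _ h x.val j.down) = x :=
  (c.point_eq_iff _ w _ h).2
    ⟨AffineSpace.homOfVector_over _ _, fun _ => AffineSpace.homOfVector_appTop_coord _ _ _⟩

lemma Chart.point_res {V W : Scheme.{u}} (v : V ⟶ W) (α : W ⟶ affine k U) :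
    (c.point α).res v = c.point (v ≫ α) := by
  have h : ((v ≫ α) ≫ affine k U ↘ U.toScheme) ≫ U.ι = v ≫ (c.point α).base := by
    change _ = v ≫ (α ≫ affine k U ↘ U.toScheme) ≫ U.ι
    simp only [Category.assoc]
  refine ((c.point_eq_iff (v ≫ α) ((v ≫ α) ≫ affine k U ↘ U.toScheme) _ h).2
    ⟨rfl, fun j => ?_⟩).symm
  refine Eq.trans ?_ (c.natural v (α ≫ affine k U ↘ U.toScheme) _ (Category.assoc _ _ _).symm
    (c.point α).base (v ≫ (c.point α).base) rfl h rfl (c.point α).val j).symm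
  rw [Scheme.Hom.comp_appTop, CommRingCat.comp_apply]
  exact congrArg _ (c.equiv_point_val α rfl j).symm

/-- The morphism from the affine space over `U` given by a chart. -/
def Chart.toTotal : yoneda.obj (affine k U) ⟶ totalFunctor P where
  app W := ↾fun α => c.point α
  naturality V W v := by
    ext α
    exact (c.point_res v.unop α).symm

/-- If the restriction of `x` along `W ⟶ T` comes from the chart, then its base morphism factors
through `U`, so `W ⟶ T` factors through the preimage of `U`. On that preimage the coordinates of `x`
give the morphism to affine space. -/
lemma Chart.isPullback {T V : Scheme.{u}} (x : TotalPoint P T) (i : V ⟶ T) (w : V ⟶ U.toScheme)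
    (h : w ≫ U.ι = i ≫ x.base) [IsOpenImmersion i] (hV : x.base ⁻¹ᵁ U ≤ i.opensRange) :
    IsPullback (yoneda.map (AffineSpace.homOfVector w fun j =>
      c.equiv w _ h (x.res i).val j.down : V ⟶ affine k U)) (yoneda.map i)
      c.toTotal (yonedaEquiv.symm (x : (totalFunctor P).obj (op T))) := by
  set α : V ⟶ affine k U := AffineSpace.homOfVector w fun j =>
      c.equiv w _ h (x.res i).val j.down with hα
  have hpt : c.point α = x.res i := c.point_homOfVector w (x.res i) h
  refine IsPullback.of_forall_isPullback_app fun W => ?_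
  rw [Types.isPullback_iff]
  refine ⟨?_, ?_, ?_⟩
  · ext β
    change c.point (β ≫ α) = x.res (β ≫ i)
    rw [← c.point_res, hpt]
    exact x.res_res _ _
  · rintro β β' ⟨-, e⟩
    exact (cancel_mono i).1 e
  · intro (β : W.unop ⟶ affine k U) (t : W.unop ⟶ T) e
    replace e : c.point β = x.res t := e
    have hb : (β ≫ affine k U ↘ U.toScheme) ≫ U.ι = t ≫ x.base := congrArg TotalPoint.base e
    have ht : Set.range t ⊆ Set.range i := by
      rintro _ ⟨z, rfl⟩
      apply hV
      have : (t ≫ x.base) z = U.ι ((β ≫ affine k U ↘ U.toScheme) z) := by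
        rw [← hb]; rfl
      change x.base (t z) ∈ U
      rw [Scheme.Hom.comp_apply] at this
      rw [this]
      exact ((β ≫ affine k U ↘ U.toScheme) z).2
    refine ⟨IsOpenImmersion.lift i t ht, ?_, IsOpenImmersion.lift_fac i t ht⟩
    change IsOpenImmersion.lift i t ht ≫ α = β
    have e₁ : c.point (IsOpenImmersion.lift i t ht ≫ α) = x.res t := by
      rw [← c.point_res, hpt, TotalPoint.res_res, IsOpenImmersion.lift_fac]
    obtain ⟨h₁, h₂⟩ := (c.point_eq_iff _ (β ≫ affine k U ↘ U.toScheme) _ hb).1 e₁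
    obtain ⟨h₃, h₄⟩ := (c.point_eq_iff _ (β ≫ affine k U ↘ U.toScheme) _ hb).1 e
    exact AffineSpace.hom_ext (h₁.trans h₃.symm) fun j => (h₂ j.down).trans (h₄ j.down).symm

lemma Chart.exists_lift {T : Scheme.{u}} (x : TotalPoint P T) :
    ∃ w : (x.base ⁻¹ᵁ U).toScheme ⟶ U.toScheme, w ≫ U.ι = (x.base ⁻¹ᵁ U).ι ≫ x.base :=
  ⟨x.base ∣_ U, morphismRestrict_ι _ _⟩

lemma Chart.isOpenImmersion_toTotal : IsOpenImmersion.presheaf c.toTotal := by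
  refine MorphismProperty.relative.of_exists fun T g => ?_
  obtain ⟨x, rfl⟩ := yonedaEquiv.symm.surjective g
  obtain ⟨w, hw⟩ := Chart.exists_lift (U := U) x
  refine ⟨_, _, _, c.isPullback x (Scheme.Opens.ι _) w hw ?_, inferInstance⟩
  rw [Scheme.Opens.opensRange_ι]

lemma sigmaDesc_app_point {ι : Type u} (U : ι → S.Opens) (c : ∀ i, Chart P k (U i)) (i : ι)
    {W : Scheme.{u}} (α : W ⟶ affine k (U i)) :
    (Sigma.desc fun i => (c i).toTotal).app (op W)
      ((Sigma.ι (fun i => yoneda.obj (affine k (U i))) i).app (op W) α) = (c i).point α := by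
  change (Sigma.ι (fun i => yoneda.obj (affine k (U i))) i ≫
    Sigma.desc fun i => (c i).toTotal).app (op W) α = _
  rw [Sigma.ι_desc]
  rfl

/-- The preimages of the `U i` under the base morphism cover `T`, and on each of them the given
point comes from a chart. -/
lemma isLocallySurjective_toTotal {ι : Type u} (U : ι → S.Opens) (hU : ∀ x, ∃ i, x ∈ U i)
    (c : ∀ i, Chart P k (U i)) :
    Presheaf.IsLocallySurjective Scheme.zariskiTopology (Sigma.desc fun i => (c i).toTotal) where
  imageSieve_mem {T} x := by
    let x' : TotalPoint P T := x
    let 𝓤 : T.OpenCover := T.openCoverOfIsOpenCover (fun i => x'.base ⁻¹ᵁ U i) (by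
      refine (TopologicalSpace.Opens.ext ?_)
      ext z
      obtain ⟨i, hi⟩ := hU (x'.base z)
      simp only [TopologicalSpace.Opens.coe_iSup, Set.mem_iUnion]
      exact ⟨fun _ => trivial, fun _ => ⟨i, hi⟩⟩)
    refine GrothendieckTopology.superset_covering _ ?_ 𝓤.mem_grothendieckTopology
    rw [Sieve.generate_le_iff]
    rintro _ _ ⟨i⟩
    obtain ⟨w, hw⟩ := Chart.exists_lift (U := U i) x'
    let α : (x'.base ⁻¹ᵁ U i).toScheme ⟶ affine k (U i) :=
      AffineSpace.homOfVector w fun j => (c i).equiv w _ hw (x'.res (Scheme.Opens.ι _)).val j.down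
    refine ⟨(Sigma.ι (fun i => yoneda.obj (affine k (U i))) i).app _ α, ?_⟩
    exact (sigmaDesc_app_point U c i α).trans
      ((c i).point_homOfVector w (x'.res (Scheme.Opens.ι (x'.base ⁻¹ᵁ U i))) hw)

end Charts

/-! ### From charts to a representing vector bundle -/

section Representability

variable {S : Scheme.{u}} {P : (Over S)ᵒᵖ ⥤ Type u} {k : ℕ}

/-- A representation of the total functor gives a representation of the functor on `S`-schemes. -/
def representableByOfTotal {X : Scheme.{u}} (r : (totalFunctor P).RepresentableBy X)
    (ξ : TotalPoint P X) (hξ : ∀ {T : Scheme.{u}} (v : T ⟶ X), r.homEquiv v = ξ.res v) :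
    P.RepresentableBy (Over.mk ξ.base) where
  homEquiv {T} := Equiv.ofBijective (fun v => P.map v.op ξ.val) (by
    constructor
    · intro v v' e
      refine Over.OverMorphism.ext (r.homEquiv.injective ?_)
      rw [hξ, hξ]
      have h₁ : ξ.res v.left = ⟨T.hom, P.map v.op ξ.val⟩ :=
        TotalPoint.res_eq _ _ _ (Over.w v) rfl
      have h₂ : ξ.res v'.left = ⟨T.hom, P.map v'.op ξ.val⟩ :=
        TotalPoint.res_eq _ _ _ (Over.w v') rfl
      refine (h₁.trans ?_).trans h₂.symm
      exact congrArg _ e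
    · intro a
      obtain ⟨v, hv⟩ := r.homEquiv.surjective (⟨T.hom, a⟩ : TotalPoint P T.left)
      have hv' : ξ.res v = ⟨T.hom, a⟩ := (hξ v).symm.trans hv
      exact ⟨Over.homMk v (TotalPoint.base_of_res_eq hv'), TotalPoint.restr_of_res_eq hv' _⟩)
  homEquiv_comp v w := by
    change P.map (v ≫ w).op ξ.val = P.map v.op (P.map w.op ξ.val)
    rw [op_comp, P.map_comp]
    rfl

theorem exists_representableBy (hP : IsZariskiSheaf P)
    (hc : ∀ x, ∃ U : S.Opens, x ∈ U ∧ Nonempty (Chart P k U)) :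
    ∃ L : Over S, Nonempty (P.RepresentableBy L) := by
  choose U hU hc using hc
  have c := fun x => (hc x).some
  let F : Sheaf Scheme.zariskiTopology.{u} (Type u) :=
    ⟨totalFunctor P, (isSheaf_iff_isSheaf_of_type _ _).2 (isSheaf_totalFunctor hP)⟩
  have := isLocallySurjective_toTotal U (fun x => ⟨x, hU x⟩) c
  have hr := Scheme.LocalRepresentability.isRepresentable (F := F)
    (f := fun x => (c x).toTotal) fun x => (c x).isOpenImmersion_toTotal
  obtain ⟨X, ⟨r⟩⟩ := hr
  -- The universal pair is the one that corresponds to the identity; its base morphism makes `X` an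
  -- `S`-scheme.
  refine ⟨_, ⟨representableByOfTotal (P := P) r (r.homEquiv (𝟙 X)) fun v => ?_⟩⟩
  exact (congrArg r.homEquiv (Category.comp_id v).symm).trans (r.homEquiv_comp v (𝟙 X))

variable {U : S.Opens} (c : Chart P k U)

/-- The restriction of `P` to `U` is represented by the base change of a scheme representing `P`. -/
def representableByPullback {L : Over S} (h : P.RepresentableBy L) (U : S.Opens) :
    ((Over.map U.ι).op ⋙ P).RepresentableBy ((Over.pullback U.ι).obj L) where
  homEquiv {T} := ((Over.mapPullbackAdj U.ι).homEquiv T L).symm.trans h.homEquiv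
  homEquiv_comp v w := by
    simp only [Equiv.trans_apply, Adjunction.homEquiv_naturality_left_symm, h.homEquiv_comp]
    rfl

/-- Morphisms to the affine space correspond to elements of `P`, if `P` has a chart on `U`. -/
def Chart.overEquiv (T : Over U.toScheme) :
    (T ⟶ Over.mk (affine k U ↘ U.toScheme)) ≃ P.obj (op (Over.mk (T.hom ≫ U.ι))) where
  toFun v := (c.equiv T.hom _ rfl).symm fun j =>
    v.left.appTop (AffineSpace.coord U.toScheme (ULift.up j))
  invFun a := Over.homMk (AffineSpace.homOfVector T.hom fun j => c.equiv T.hom _ rfl a j.down)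
    (AffineSpace.homOfVector_over _ _)
  left_inv v := by
    refine Over.OverMorphism.ext (AffineSpace.hom_ext ?_ fun j => ?_)
    · exact (AffineSpace.homOfVector_over _ _).trans (Over.w v).symm
    · refine (AffineSpace.homOfVector_appTop_coord _ _ _).trans ?_
      rw [Equiv.apply_symm_apply]
  right_inv a := by
    rw [Equiv.symm_apply_eq]
    funext j
    exact AffineSpace.homOfVector_appTop_coord _ _ _

lemma Chart.equiv_overEquiv {T : Over U.toScheme}
    (v : T ⟶ Over.mk (affine k U ↘ U.toScheme)) (j : Fin k) :
    c.equiv T.hom _ rfl (c.overEquiv T v) j =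
      v.left.appTop (AffineSpace.coord U.toScheme (ULift.up j)) :=
  congrFun (Equiv.apply_symm_apply (c.equiv T.hom _ rfl) _) j

lemma Chart.overEquiv_comp {T T' : Over U.toScheme} (v : T ⟶ T')
    (w : T' ⟶ Over.mk (affine k U ↘ U.toScheme))
    (h : v.left ≫ T'.hom ≫ U.ι = T.hom ≫ U.ι) :
    c.overEquiv T (v ≫ w) = restr P v.left _ _ h (c.overEquiv T' w) := by
  apply (c.equiv T.hom _ rfl).injective
  funext j
  rw [c.natural v.left T'.hom T.hom (Over.w v) _ _ rfl, c.equiv_overEquiv, c.equiv_overEquiv,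
    Over.comp_left, Scheme.Hom.comp_appTop, CommRingCat.comp_apply]

/-- The restriction of `P` to `U` is represented by the affine space, if `P` has a chart on `U`. -/
def Chart.representableBy : ((Over.map U.ι).op ⋙ P).RepresentableBy
    (Over.mk (affine k U ↘ U.toScheme)) where
  homEquiv {T} := c.overEquiv T
  homEquiv_comp v w := c.overEquiv_comp v w (Over.w ((Over.map U.ι).map v))

lemma comp_uniqueUpToIso_hom {C : Type*} [Category C] {Q : Cᵒᵖ ⥤ Type*} {X Y T : C}
    (r : Q.RepresentableBy X) (r' : Q.RepresentableBy Y) (a : Q.obj (op T)) :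
    r.homEquiv.symm a ≫ (r.uniqueUpToIso r').hom = r'.homEquiv.symm a := by
  have e : (r.uniqueUpToIso r').hom = r'.homEquiv.symm (r.homEquiv (𝟙 X)) := rfl
  rw [e, r'.comp_homEquiv_symm, ← r.homEquiv_comp, Category.comp_id, Equiv.apply_symm_apply]

/-- The coordinates of elements of `P` over a scheme over `U`. -/
def Chart.overCoords (T : Over U.toScheme) (a : P.obj (op ((Over.map U.ι).obj T))) :
    Fin k → Γ(((Over.map U.ι).obj T).left, ⊤) :=
  c.equiv T.hom _ rfl a

/-- Base change of `L` and affine space represent the same functor over `U`, and the comparison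
isomorphism respects the elements represented. Linearity of `coords` can therefore be checked on the
chart. -/
lemma coords_eq {L : Over S} (h : P.RepresentableBy L) (T : Over U.toScheme)
    (a : P.obj (op ((Over.map U.ι).obj T))) :
    coords h ((representableByPullback h U).uniqueUpToIso c.representableBy) T a =
      c.overCoords T a := by
  funext j
  have e := comp_uniqueUpToIso_hom (representableByPullback h U) c.representableBy (T := T) a
  have e' := congrArg (fun v : T ⟶ Over.mk (affine k U ↘ U.toScheme) =>
    v.left.appTop (AffineSpace.coord U.toScheme (ULift.up j))) e
  exact e'.trans (AffineSpace.homOfVector_appTop_coord _ _ _)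

theorem representedByVectorBundle_of_charts [∀ T, AddCommGroup (P.obj T)]
    [∀ T : (Over S)ᵒᵖ, Module Γ(T.unop.left, ⊤) (P.obj T)] (hP : IsZariskiSheaf P)
    (hc : ∀ x, ∃ U : S.Opens, x ∈ U ∧ ∃ c : Chart P k U, ∀ T : Over U.toScheme,
      IsLinearMap Γ(((Over.map U.ι).obj T).left, ⊤) (c.overCoords T)) :
    RepresentedByVectorBundle P k := by
  obtain ⟨L, ⟨h⟩⟩ := exists_representableBy (k := k) hP fun x => by
    obtain ⟨U, hU, c, -⟩ := hc x
    exact ⟨U, hU, ⟨c⟩⟩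
  refine ⟨L, h, fun x => ?_⟩
  obtain ⟨U, hU, c, hl⟩ := hc x
  refine ⟨U, hU, (representableByPullback h U).uniqueUpToIso c.representableBy, fun T => ?_⟩
  have e : coords h ((representableByPullback h U).uniqueUpToIso c.representableBy) T =
    c.overCoords T := funext fun a => coords_eq c h T a
  rw [e]
  exact hl T

end Representability

/-! ### Zariski descent for linked tuples -/

section Descent

variable {S : Scheme.{u}} {n : ℕ} (F G : Chain S n)

lemma linkedHom_ext {F G : Chain S n} {T : Scheme.{u}} {f : T ⟶ S}
    {φ ψ : (linkedHom F G).obj (op (Over.mk f))} (h : ∀ i, φ.1 i = ψ.1 i) : φ = ψ :=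
  Subtype.ext (funext h)

lemma restr_linkedHom {F G : Chain S n} {W T : Scheme.{u}} (v : W ⟶ T) (f : T ⟶ S) (g : W ⟶ S)
    (h : v ≫ f = g) (φ : (linkedHom F G).obj (op (Over.mk f))) (i : Fin n) :
    (restr (linkedHom F G) v f g h φ).1 i = resHom v f g h (φ.1 i) := rfl

/-- The components glue one by one. The linking relations are equalities of homomorphisms whose two
sides commute with restriction, so they hold because they hold on the cover. -/
theorem isZariskiSheaf_linkedHom : IsZariskiSheaf (linkedHom F G) where
  eq_of_restr v _ hv f g h a b e := by
    refine linkedHom_ext fun i => eq_of_resHom v hv f g h _ _ fun j => ?_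
    rw [← restr_linkedHom, ← restr_linkedHom, e]
  exists_glue v _ hv f g h a e := by
    have he : ∀ i j k, resHom (pullback.fst (v j) (v k)) (g j) (pullback.fst (v j) (v k) ≫ g j) rfl
        ((a j).1 i) = resHom (pullback.snd (v j) (v k)) (g k) (pullback.fst (v j) (v k) ≫ g j)
        (by rw [← h j, ← h k, pullback.condition_assoc]) ((a k).1 i) := by
      intro i j k
      rw [← restr_linkedHom, ← restr_linkedHom, e]
    have hb : ∀ i j, resHom (v j) f (g j) (h j)
        (glueHom v hv f g h (fun j => (a j).1 i) (he i)) = (a j).1 i := fun i j =>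
      resHom_glueHom v hv f g h _ _ j
    refine ⟨⟨fun i => glueHom v hv f g h (fun j => (a j).1 i) (he i), fun i hi => ⟨?_, ?_⟩⟩,
      fun j => linkedHom_ext fun i => (restr_linkedHom _ _ _ _ _ _).trans (hb i j)⟩
    · refine eq_of_resHom v hv f g h _ _ fun j => ?_
      change resHom (v j) f (g j) (h j) ((Scheme.Modules.pullback f).map _ ≫ _) =
        resHom (v j) f (g j) (h j) (_ ≫ (Scheme.Modules.pullback f).map _)
      rw [resHom_map_comp, resHom_comp_map, hb, hb]
      exact ((a j).2 i hi).1
    · refine eq_of_resHom v hv f g h _ _ fun j => ?_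
      change resHom (v j) f (g j) (h j) ((Scheme.Modules.pullback f).map _ ≫ _) =
        resHom (v j) f (g j) (h j) (_ ≫ (Scheme.Modules.pullback f).map _)
      rw [resHom_map_comp, resHom_comp_map, hb, hb]
      exact ((a j).2 i hi).2

end Descent

/-! ### Charts of the linked Hom functor -/

section SplitCharts

variable {S X Y Z : Scheme.{u}} {n : ℕ} {ι κ : Type*} [Fintype ι] [DecidableEq ι]
  [Fintype κ] [DecidableEq κ]

omit [Fintype ι] [DecidableEq ι] in
lemma Frame.ext_sec {M : X.Modules} {E E' : Frame M ι} (h : E.sec = E'.sec) : E = E' := by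
  cases E
  cases E'
  cases h
  rfl

omit [Fintype ι] [DecidableEq ι] in
lemma Frame.pull_pull {W : Scheme.{u}} {M : X.Modules} (w : W ⟶ Z) (v : Z ⟶ Y) (wv : W ⟶ Y)
    (hwv : w ≫ v = wv) (f : Y ⟶ X) (g : Z ⟶ X) (k : W ⟶ X) (h : v ≫ f = g) (h' : w ≫ g = k)
    (h'' : wv ≫ f = k) (E : Frame ((Scheme.Modules.pullback f).obj M) ι) :
    (E.pull v f g h).pull w g k h' = E.pull wv f k h'' := by
  subst hwv
  refine Frame.ext_sec (funext fun j => ?_)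
  rw [Frame.pull_sec, Frame.pull_sec, Frame.pull_sec, pullTop_comp v f g h w k h' h'']

/-- The matrices of the maps going up in a chain, in terms of frames. -/
def upMatrix (C : Chain S n) (f : Y ⟶ S)
    (E : ∀ i, Frame ((Scheme.Modules.pullback f).obj (C.obj i)) ι) (i : ℕ) :
    Matrix ι ι Γ(Y, ⊤) :=
  if hi : i + 1 < n then
    homMatrix (E ⟨i, Nat.lt_of_succ_lt hi⟩) (E ⟨i + 1, hi⟩)
      ((Scheme.Modules.pullback f).map (C.up i hi))
  else 0

/-- The matrices of the maps going down in a chain, in terms of frames. -/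
def downMatrix (C : Chain S n) (f : Y ⟶ S)
    (E : ∀ i, Frame ((Scheme.Modules.pullback f).obj (C.obj i)) ι) (i : ℕ) :
    Matrix ι ι Γ(Y, ⊤) :=
  if hi : i + 1 < n then
    homMatrix (E ⟨i + 1, hi⟩) (E ⟨i, Nat.lt_of_succ_lt hi⟩)
      ((Scheme.Modules.pullback f).map (C.down i hi))
  else 0

section

variable (C : Chain S n) (f : Y ⟶ S)
  (E : ∀ i, Frame ((Scheme.Modules.pullback f).obj (C.obj i)) ι)

lemma upMatrix_of_lt {i : ℕ} (hi : i + 1 < n) : upMatrix C f E i =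
    homMatrix (E ⟨i, Nat.lt_of_succ_lt hi⟩) (E ⟨i + 1, hi⟩)
      ((Scheme.Modules.pullback f).map (C.up i hi)) := dif_pos hi

lemma downMatrix_of_lt {i : ℕ} (hi : i + 1 < n) : downMatrix C f E i =
    homMatrix (E ⟨i + 1, hi⟩) (E ⟨i, Nat.lt_of_succ_lt hi⟩)
      ((Scheme.Modules.pullback f).map (C.down i hi)) := dif_pos hi

variable (v : Z ⟶ Y) (g : Z ⟶ S) (h : v ≫ f = g)

/-- Beyond the end of the chain both sides are the default value `0`, so the equality holds for all
indices and can be used to rewrite whole families. -/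
lemma upMatrix_pull : upMatrix C g (fun i => (E i).pull v f g h) =
    fun i => (upMatrix C f E i).map v.appTop.hom := by
  funext i
  by_cases hi : i + 1 < n
  · rw [upMatrix_of_lt _ _ _ hi, upMatrix_of_lt _ _ _ hi, homMatrix_map]
  · rw [upMatrix, upMatrix, dif_neg hi, dif_neg hi, Matrix.map_zero _ (map_zero _)]

lemma downMatrix_pull : downMatrix C g (fun i => (E i).pull v f g h) =
    fun i => (downMatrix C f E i).map v.appTop.hom := by
  funext i
  by_cases hi : i + 1 < n
  · rw [downMatrix_of_lt _ _ _ hi, downMatrix_of_lt _ _ _ hi, homMatrix_map]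
  · rw [downMatrix, downMatrix, dif_neg hi, dif_neg hi, Matrix.map_zero _ (map_zero _)]

end

variable {F G : Chain S n}

/-- The matrices of a tuple of homomorphisms, in terms of frames. -/
def tupleMatrix (f : Y ⟶ S) (E : ∀ i, Frame ((Scheme.Modules.pullback f).obj (F.obj i)) ι)
    (E' : ∀ i, Frame ((Scheme.Modules.pullback f).obj (G.obj i)) κ) :
    (∀ i, (Scheme.Modules.pullback f).obj (F.obj i) ⟶ (Scheme.Modules.pullback f).obj (G.obj i))
      ≃ₗ[Γ(Y, ⊤)] (Fin n → Matrix κ ι Γ(Y, ⊤)) :=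
  LinearEquiv.piCongrRight fun i => homMatrix (E i) (E' i)

lemma tupleMatrix_apply (f : Y ⟶ S) (E : ∀ i, Frame ((Scheme.Modules.pullback f).obj (F.obj i)) ι)
    (E' : ∀ i, Frame ((Scheme.Modules.pullback f).obj (G.obj i)) κ)
    (φ : ∀ i, (Scheme.Modules.pullback f).obj (F.obj i) ⟶
      (Scheme.Modules.pullback f).obj (G.obj i)) (i : Fin n) :
    tupleMatrix f E E' φ i = homMatrix (E i) (E' i) (φ i) := rfl

lemma isLinked_tupleMatrix_iff (f : Y ⟶ S)
    (E : ∀ i, Frame ((Scheme.Modules.pullback f).obj (F.obj i)) ι)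
    (E' : ∀ i, Frame ((Scheme.Modules.pullback f).obj (G.obj i)) κ)
    (φ : ∀ i, (Scheme.Modules.pullback f).obj (F.obj i) ⟶
      (Scheme.Modules.pullback f).obj (G.obj i)) :
    IsLinked n (upMatrix F f E) (downMatrix F f E) (upMatrix G f E') (downMatrix G f E')
      (tupleMatrix f E E' φ) ↔ φ ∈ linkedTuples F G (Over.mk f) := by
  have key : ∀ (i : ℕ) (hi : i + 1 < n),
      (tupleMatrix f E E' φ ⟨i + 1, hi⟩ * upMatrix F f E i =
        upMatrix G f E' i * tupleMatrix f E E' φ ⟨i, Nat.lt_of_succ_lt hi⟩ ∧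
      tupleMatrix f E E' φ ⟨i, Nat.lt_of_succ_lt hi⟩ * downMatrix F f E i =
        downMatrix G f E' i * tupleMatrix f E E' φ ⟨i + 1, hi⟩) ↔
      ((Scheme.Modules.pullback f).map (F.up i hi) ≫ φ ⟨i + 1, hi⟩ =
        φ ⟨i, Nat.lt_of_succ_lt hi⟩ ≫ (Scheme.Modules.pullback f).map (G.up i hi) ∧
      (Scheme.Modules.pullback f).map (F.down i hi) ≫ φ ⟨i, Nat.lt_of_succ_lt hi⟩ =
        φ ⟨i + 1, hi⟩ ≫ (Scheme.Modules.pullback f).map (G.down i hi)) := by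
    intro i hi
    rw [upMatrix_of_lt _ _ _ hi, upMatrix_of_lt _ _ _ hi, downMatrix_of_lt _ _ _ hi,
      downMatrix_of_lt _ _ _ hi, tupleMatrix_apply, tupleMatrix_apply, ← homMatrix_comp,
      ← homMatrix_comp, ← homMatrix_comp, ← homMatrix_comp, EmbeddingLike.apply_eq_iff_eq,
      EmbeddingLike.apply_eq_iff_eq]
  exact forall₂_congr key

variable {r m : ℕ}

/-- The entries of a matrix, as a vector. -/
def entries (r m : ℕ) (R : Type*) [Semiring R] :
    Matrix (Fin m) (Fin r) R ≃ₗ[R] (Fin (r * m) → R) where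
  toFun A j := A (finProdFinEquiv.symm j).2 (finProdFinEquiv.symm j).1
  invFun a := fun k j => a (finProdFinEquiv (j, k))
  map_add' A B := rfl
  map_smul' c A := rfl
  left_inv A := by
    ext k j
    simp
  right_inv a := by
    funext j
    exact congrArg a (finProdFinEquiv.apply_symm_apply j)

/-- Coordinates of a linked tuple: the entries of its outer components. -/
def linkedCoords (hn : 1 ≤ n) (f : Y ⟶ S)
    (E : ∀ i, Frame ((Scheme.Modules.pullback f).obj (F.obj i)) (Fin r))
    (E' : ∀ i, Frame ((Scheme.Modules.pullback f).obj (G.obj i)) (Fin m))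
    (P Q : Matrix (Fin m) (Fin m) Γ(Y, ⊤)) (φ : linkedTuples F G (Over.mk f)) :
    Fin (r * m) → Γ(Y, ⊤) :=
  entries r m _ (outer hn P Q (tupleMatrix f E E' φ.1))

/-- Frames turn linked tuples into linked families of matrices, to which `Splitting.outer_bijective`
applies. -/
lemma linkedCoords_bijective (hn : 1 ≤ n) (f : Y ⟶ S)
    (E : ∀ i, Frame ((Scheme.Modules.pullback f).obj (F.obj i)) (Fin r))
    (E' : ∀ i, Frame ((Scheme.Modules.pullback f).obj (G.obj i)) (Fin m))
    (s : Γ(Y, ⊤)) (P Q D : Matrix (Fin m) (Fin m) Γ(Y, ⊤))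
    (h : Splitting n s (upMatrix F f E) (downMatrix F f E) (upMatrix G f E') (downMatrix G f E')
      P Q D) : Function.Bijective (linkedCoords (F := F) (G := G) hn f E E' P Q) := by
  have h₁ : Function.Bijective fun φ : linkedTuples F G (Over.mk f) =>
      (⟨tupleMatrix f E E' φ.1, (isLinked_tupleMatrix_iff f E E' φ.1).2 φ.2⟩ :
        {Φ // IsLinked n (upMatrix F f E) (downMatrix F f E) (upMatrix G f E')
          (downMatrix G f E') Φ}) := by
    constructor
    · intro φ ψ e
      exact Subtype.ext ((tupleMatrix f E E').injective (congrArg Subtype.val e))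
    · rintro ⟨Φ, hΦ⟩
      obtain ⟨φ, rfl⟩ := (tupleMatrix f E E').surjective Φ
      exact ⟨⟨φ, (isLinked_tupleMatrix_iff f E E' φ).1 hΦ⟩, rfl⟩
  have h₂ := (h.outer_bijective (ι := Fin r) hn).comp h₁
  exact (entries r m _).bijective.comp h₂

lemma linkedCoords_isLinearMap (hn : 1 ≤ n) (f : Y ⟶ S)
    (E : ∀ i, Frame ((Scheme.Modules.pullback f).obj (F.obj i)) (Fin r))
    (E' : ∀ i, Frame ((Scheme.Modules.pullback f).obj (G.obj i)) (Fin m))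
    (P Q : Matrix (Fin m) (Fin m) Γ(Y, ⊤)) :
    (∀ φ ψ, linkedCoords (F := F) (G := G) hn f E E' P Q (φ + ψ) =
      linkedCoords hn f E E' P Q φ + linkedCoords hn f E E' P Q ψ) ∧
    ∀ (c : Γ(Y, ⊤)) φ, linkedCoords (F := F) (G := G) hn f E E' P Q (c • φ) =
      c • linkedCoords hn f E E' P Q φ := by
  constructor
  · intro φ ψ
    rw [linkedCoords, linkedCoords, linkedCoords, ← map_add]
    congr 1
    have e : tupleMatrix f E E' (φ + ψ).1 = tupleMatrix f E E' φ.1 + tupleMatrix f E E' ψ.1 :=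
      map_add _ _ _
    rw [e, outer, outer, outer, Pi.add_apply, Pi.add_apply, Matrix.mul_add, Matrix.mul_add]
    abel
  · intro c φ
    rw [linkedCoords, linkedCoords, ← map_smul]
    congr 1
    have e : tupleMatrix f E E' (c • φ).1 = c • tupleMatrix f E E' φ.1 := map_smul _ _ _
    rw [e, outer, outer, Pi.smul_apply, Pi.smul_apply, Matrix.mul_smul, Matrix.mul_smul, smul_add]

omit [Fintype ι] [DecidableEq ι] [DecidableEq κ] in
lemma outer_map {R R' : Type*} [CommRing R] [CommRing R'] (f : R →+* R') (hn : 1 ≤ n)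
    (P Q : Matrix κ κ R) (Φ : Fin n → Matrix κ ι R) :
    (outer hn P Q Φ).map f = outer hn (P.map f) (Q.map f) fun i => (Φ i).map f := by
  rw [outer, outer, Matrix.map_add _ (map_add f), Matrix.map_mul, Matrix.map_mul]

lemma linkedCoords_eq_of_resHom (hn : 1 ≤ n) (v : Z ⟶ Y) (f : Y ⟶ S) (g : Z ⟶ S) (h : v ≫ f = g)
    (E : ∀ i, Frame ((Scheme.Modules.pullback f).obj (F.obj i)) (Fin r))
    (E' : ∀ i, Frame ((Scheme.Modules.pullback f).obj (G.obj i)) (Fin m))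
    (P Q : Matrix (Fin m) (Fin m) Γ(Y, ⊤)) (φ : linkedTuples F G (Over.mk f))
    (ψ : linkedTuples F G (Over.mk g)) (hψ : ∀ i, ψ.1 i = resHom v f g h (φ.1 i))
    (j : Fin (r * m)) :
    linkedCoords hn g (fun i => (E i).pull v f g h) (fun i => (E' i).pull v f g h)
      (P.map v.appTop.hom) (Q.map v.appTop.hom) ψ j =
    v.appTop (linkedCoords hn f E E' P Q φ j) := by
  have e : tupleMatrix g (fun i => (E i).pull v f g h) (fun i => (E' i).pull v f g h) ψ.1 =
      fun i => (tupleMatrix f E E' φ.1 i).map v.appTop.hom := by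
    funext i
    rw [tupleMatrix_apply, tupleMatrix_apply, hψ, homMatrix_resHom]
  rw [linkedCoords, linkedCoords, e, ← outer_map]
  rfl

lemma linkedCoords_restr (hn : 1 ≤ n) (v : Z ⟶ Y) (f : Y ⟶ S) (g : Z ⟶ S) (h : v ≫ f = g)
    (E : ∀ i, Frame ((Scheme.Modules.pullback f).obj (F.obj i)) (Fin r))
    (E' : ∀ i, Frame ((Scheme.Modules.pullback f).obj (G.obj i)) (Fin m))
    (P Q : Matrix (Fin m) (Fin m) Γ(Y, ⊤)) (φ : (linkedHom F G).obj (op (Over.mk f)))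
    (j : Fin (r * m)) :
    linkedCoords hn g (fun i => (E i).pull v f g h) (fun i => (E' i).pull v f g h)
      (P.map v.appTop.hom) (Q.map v.appTop.hom) (restr (linkedHom F G) v f g h φ) j =
    v.appTop (linkedCoords hn f E E' P Q φ j) :=
  linkedCoords_eq_of_resHom hn v f g h E E' P Q φ (restr (linkedHom F G) v f g h φ)
    (restr_linkedHom v f g h φ) j

/-- The chart of the linked Hom functor given by frames and a splitting of the chains. -/
def splitChart (hn : 1 ≤ n) (U : S.Opens)
    (E : ∀ i, Frame ((Scheme.Modules.pullback U.ι).obj (F.obj i)) (Fin r))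
    (E' : ∀ i, Frame ((Scheme.Modules.pullback U.ι).obj (G.obj i)) (Fin m))
    (s : Γ(U.toScheme, ⊤)) (P Q D : Matrix (Fin m) (Fin m) Γ(U.toScheme, ⊤))
    (h : Splitting n s (upMatrix F U.ι E) (downMatrix F U.ι E) (upMatrix G U.ι E')
      (downMatrix G U.ι E') P Q D) : Chart (linkedHom F G) (r * m) U where
  equiv w g e := Equiv.ofBijective (linkedCoords hn g (fun i => (E i).pull w U.ι g e)
      (fun i => (E' i).pull w U.ι g e) (P.map w.appTop.hom) (Q.map w.appTop.hom)) (by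
    -- A splitting over `U` consists of matrix identities and units, which any ring homomorphism
    -- preserves.
    apply linkedCoords_bijective hn g _ _ (w.appTop.hom s) _ _ (D.map w.appTop.hom)
    rw [upMatrix_pull, downMatrix_pull, upMatrix_pull, downMatrix_pull]
    exact h.map _)
  natural v t w e f g h₁ h₂ h₃ φ j := by
    subst e
    have := linkedCoords_restr hn v f g h₃ (fun i => (E i).pull t U.ι f h₁)
      (fun i => (E' i).pull t U.ι f h₁) (P.map t.appTop.hom) (Q.map t.appTop.hom) φ j
    refine Eq.trans ?_ this
    -- Pulling the frames back in one step or in two gives the same frames, so naturality is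
    -- `linkedCoords_restr`.
    change linkedCoords hn g (fun i => (E i).pull (v ≫ t) U.ι g h₂)
      (fun i => (E' i).pull (v ≫ t) U.ι g h₂) (P.map (v ≫ t).appTop.hom)
      (Q.map (v ≫ t).appTop.hom) _ j = _
    simp only [Frame.pull_pull v t _ rfl U.ι f g h₁ h₃ h₂, Matrix.map_map,
      Scheme.Hom.comp_appTop]
    rfl

instance linkedHomModule (T : Over S) : Module Γ(T.left, ⊤) ((linkedHom F G).obj (op T)) :=
  inferInstanceAs (Module Γ(T.left, ⊤) (linkedTuples F G T))

lemma splitChart_isLinearMap (hn : 1 ≤ n) (U : S.Opens)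
    (E : ∀ i, Frame ((Scheme.Modules.pullback U.ι).obj (F.obj i)) (Fin r))
    (E' : ∀ i, Frame ((Scheme.Modules.pullback U.ι).obj (G.obj i)) (Fin m))
    (s : Γ(U.toScheme, ⊤)) (P Q D : Matrix (Fin m) (Fin m) Γ(U.toScheme, ⊤))
    (h : Splitting n s (upMatrix F U.ι E) (downMatrix F U.ι E) (upMatrix G U.ι E')
      (downMatrix G U.ι E') P Q D) (T : Over U.toScheme) :
    IsLinearMap Γ(((Over.map U.ι).obj T).left, ⊤)
      ((splitChart hn U E E' s P Q D h).overCoords T) := by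
  have := linkedCoords_isLinearMap (F := F) (G := G) hn (T.hom ≫ U.ι)
    (fun i => (E i).pull T.hom U.ι _ rfl) (fun i => (E' i).pull T.hom U.ι _ rfl)
    (P.map T.hom.appTop.hom) (Q.map T.hom.appTop.hom)
  exact ⟨this.1, this.2⟩

end SplitCharts

/-! ### Scalars under pullback, and linear maps in bases -/

section Transfer

variable {X Y : Scheme.{u}}

/-- By adjunction it suffices to compare both sides on pulled back sections. -/
lemma pullback_map_smul_id (f : Y ⟶ X) (M : X.Modules) (s : Γ(X, ⊤)) :
    (Scheme.Modules.pullback f).map (s • 𝟙 M) = (f.appTop s : Γ(Y, ⊤)) • 𝟙 _ := by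
  apply ((Scheme.Modules.pullbackPushforwardAdjunction f).homEquiv M _).injective
  ext U x
  have h₁ : ((Scheme.Modules.pullback f).map (s • 𝟙 M)).app (f ⁻¹ᵁ U) (unitSec f U x) =
      ((f.appTop s : Γ(Y, ⊤)) • 𝟙 ((Scheme.Modules.pullback f).obj M)).app (f ⁻¹ᵁ U)
        (unitSec f U x) := by
    rw [unitSec_map, smul_app, smul_app]
    refine (unitSec_smul f U _ x).trans ?_
    congr 1
    exact ConcreteCategory.congr_hom (f.naturality (homOfLE (le_top : U ≤ ⊤)).op) s
  rw [Adjunction.homEquiv_unit, Adjunction.homEquiv_unit]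
  exact h₁

variable {K : Type*} [CommRing K] {M N : Type*} [AddCommGroup M] [Module K M] [AddCommGroup N]
  [Module K N] {ι κ : Type*} [Fintype ι] [DecidableEq ι] [Fintype κ] [DecidableEq κ]

omit [DecidableEq κ] in
lemma mulVecLin_toMatrix (b : Module.Basis ι K M) (b' : Module.Basis κ K N) (l : M →ₗ[K] N) :
    (LinearMap.toMatrix b b' l).mulVecLin =
      b'.equivFun.toLinearMap ∘ₗ l ∘ₗ b.equivFun.symm.toLinearMap :=
  Matrix.toLin'_toMatrix' (b'.equivFun.toLinearMap ∘ₗ l ∘ₗ b.equivFun.symm.toLinearMap)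

omit [DecidableEq κ] in
lemma range_mulVecLin_toMatrix (b : Module.Basis ι K M) (b' : Module.Basis κ K N) (l : M →ₗ[K] N) :
    LinearMap.range (LinearMap.toMatrix b b' l).mulVecLin =
      (LinearMap.range l).map b'.equivFun.toLinearMap := by
  rw [mulVecLin_toMatrix, LinearMap.range_comp, LinearMap.range_comp_of_range_eq_top]
  exact LinearEquiv.range _

omit [DecidableEq κ] in
lemma ker_mulVecLin_toMatrix (b : Module.Basis ι K M) (b' : Module.Basis κ K N) (l : M →ₗ[K] N) :
    LinearMap.ker (LinearMap.toMatrix b b' l).mulVecLin =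
      (LinearMap.ker l).map b.equivFun.toLinearMap := by
  rw [mulVecLin_toMatrix, LinearEquiv.ker_comp, LinearMap.ker_comp]
  exact (Submodule.map_equiv_eq_comap_symm b.equivFun (LinearMap.ker l)).symm

lemma isCompl_map_equiv (e : M ≃ₗ[K] N) {p q : Submodule K M} (h : IsCompl p q) :
    IsCompl (p.map e.toLinearMap) (q.map e.toLinearMap) :=
  (Submodule.orderIsoMapComap e).isCompl h

/-- The witness is the composite of the upward maps back to the `i`-th module; neighbouring pairs
collapse to `s` from the inside out. -/
lemma downProd_mul_exists {R : Type*} [CommRing R] {n : ℕ} {s : R} {u d : ℕ → Matrix κ κ R}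
    (hdu : ∀ i, i + 1 < n → d i * u i = s • 1) (i : ℕ) (hi : i < n) :
    ∃ A, downProd d i * A = s ^ i • 1 := by
  induction i with
  | zero => exact ⟨1, by simp [downProd]⟩
  | succ i ih =>
    obtain ⟨A, hA⟩ := ih (by omega)
    refine ⟨u i * A, ?_⟩
    rw [downProd, mul_assoc, ← mul_assoc (d i), hdu i hi, Matrix.smul_mul, one_mul,
      Matrix.mul_smul, hA, smul_smul, pow_succ, mul_comm]

lemma isUnit_downProd {R : Type*} [CommRing R] {n : ℕ} {s : R} (hs : IsUnit s)
    {u d : ℕ → Matrix κ κ R} (hdu : ∀ i, i + 1 < n → d i * u i = s • 1) (i : ℕ) (hi : i < n) :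
    IsUnit (downProd d i) := by
  obtain ⟨A, hA⟩ := downProd_mul_exists hdu i hi
  obtain ⟨t, ht⟩ := hs.pow i
  refine IsUnit.of_mul_eq_one ((↑t⁻¹ : R) • A) ?_
  rw [Matrix.mul_smul, hA, smul_smul, ← ht, Units.inv_mul, one_smul]

end Transfer

/-! ### Matrix form of the relations in a chain -/

section Matrices

variable {S Y Z : Scheme.{u}} {n : ℕ} {ι κ : Type*} [Fintype ι] [DecidableEq ι]
  [Fintype κ] [DecidableEq κ]

lemma downMatrix_mul_upMatrix (C : Chain S n) (f : Y ⟶ S)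
    (E : ∀ i, Frame ((Scheme.Modules.pullback f).obj (C.obj i)) ι) (s : Γ(S, ⊤)) (i : ℕ)
    (hi : i + 1 < n) (h : C.up i hi ≫ C.down i hi = s • 𝟙 _) :
    downMatrix C f E i * upMatrix C f E i = f.appTop s • 1 := by
  rw [downMatrix_of_lt _ _ _ hi, upMatrix_of_lt _ _ _ hi, ← homMatrix_comp, ← Functor.map_comp, h,
    pullback_map_smul_id, map_smul, homMatrix_id]

lemma upMatrix_mul_downMatrix (C : Chain S n) (f : Y ⟶ S)
    (E : ∀ i, Frame ((Scheme.Modules.pullback f).obj (C.obj i)) ι) (s : Γ(S, ⊤)) (i : ℕ)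
    (hi : i + 1 < n) (h : C.down i hi ≫ C.up i hi = s • 𝟙 _) :
    upMatrix C f E i * downMatrix C f E i = f.appTop s • 1 := by
  rw [downMatrix_of_lt _ _ _ hi, upMatrix_of_lt _ _ _ hi, ← homMatrix_comp, ← Functor.map_comp, h,
    pullback_map_smul_id, map_smul, homMatrix_id]

lemma fibreMap_eq {M N : S.Modules} (φ : M ⟶ N) (x : S) :
    fibreMap φ x = secLin ((Scheme.Modules.pullback (S.fromSpecResidueField x)).map φ) := rfl

end Matrices

/-! ### Spreading out from a point to a neighbourhood -/

section Points

variable {S : Scheme.{u}} (x : S)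

/-- The inclusion of the point `x` into an open neighbourhood. -/
def pointTo (V : S.Opens) (hx : x ∈ V) : Spec (S.residueField x) ⟶ V.toScheme :=
  Spec.map (S.residue x) ≫ V.fromSpecStalkOfMem x hx

lemma pointTo_ι (V : S.Opens) (hx : x ∈ V) :
    pointTo x V hx ≫ V.ι = S.fromSpecResidueField x := by
  rw [pointTo, Category.assoc, Scheme.Opens.fromSpecStalkOfMem_ι]
  rfl

lemma pointTo_homOfLE {U V : S.Opens} (h : V ≤ U) (hx : x ∈ V) :
    pointTo x V hx ≫ S.homOfLE h = pointTo x U (h hx) := by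
  rw [← cancel_mono U.ι, Category.assoc, Scheme.homOfLE_ι, pointTo_ι, pointTo_ι]

/-- Evaluation of a function at `x` is its germ followed by the residue map. -/
lemma topIso_inv_pointTo (V : S.Opens) (hx : x ∈ V) :
    V.topIso.inv ≫ (pointTo x V hx).appTop =
      S.presheaf.germ V x hx ≫ S.residue x ≫ (Scheme.ΓSpecIso _).inv := by
  have h := congrArg Scheme.Hom.appTop (Scheme.Opens.fromSpecStalkOfMem_toSpecΓ V x hx)
  rw [Scheme.Hom.comp_appTop, Scheme.Opens.toSpecΓ_appTop, Category.assoc, ← Iso.eq_inv_comp,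
    ← Scheme.ΓSpecIso_inv_naturality] at h
  rw [pointTo, Scheme.Hom.comp_appTop, reassoc_of% h, Scheme.ΓSpecIso_inv_naturality]

lemma topIso_inv_homOfLE {U V : S.Opens} (h : V ≤ U) :
    U.topIso.inv ≫ (S.homOfLE h).appTop = S.presheaf.map (homOfLE h).op ≫ V.topIso.inv := by
  rw [Scheme.homOfLE_appTop, Scheme.Opens.topIso_inv, Scheme.Opens.topIso_inv]
  erw [← Functor.map_comp, ← Functor.map_comp]
  rfl

/-- The stalk surjects onto the residue field, and a germ comes from a function near `x`. -/
lemma exists_pointTo_eq (k : Γ(Spec (S.residueField x), ⊤)) :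
    ∃ (V : S.Opens) (hx : x ∈ V) (c : Γ(V.toScheme, ⊤)), (pointTo x V hx).appTop c = k := by
  obtain ⟨a, ha⟩ := S.residue_surjective x ((Scheme.ΓSpecIso (S.residueField x)).hom k)
  obtain ⟨V, hx, c, rfl⟩ := S.presheaf.exists_germ_eq a
  refine ⟨V, hx, (Scheme.Opens.topIso V).inv c, ?_⟩
  have h := ConcreteCategory.congr_hom (topIso_inv_pointTo x V hx) c
  rw [CommRingCat.comp_apply, CommRingCat.comp_apply, CommRingCat.comp_apply, ha] at h
  refine h.trans ?_
  rw [← CommRingCat.comp_apply, Iso.hom_inv_id]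
  rfl

/-- The stalk is local, so a function invertible in the residue field has an invertible germ, and
invertibility of a germ spreads to a neighbourhood. -/
lemma exists_isUnit_homOfLE {V : S.Opens} (hx : x ∈ V) (c : Γ(V.toScheme, ⊤))
    (hc : IsUnit ((pointTo x V hx).appTop c)) :
    ∃ (W : S.Opens) (h : W ≤ V), x ∈ W ∧ IsUnit ((S.homOfLE h).appTop c) := by
  obtain ⟨c, rfl⟩ : ∃ c', V.topIso.inv c' = c := ⟨V.topIso.hom c, by
    rw [← CommRingCat.comp_apply, Iso.hom_inv_id]
    rfl⟩
  rw [← CommRingCat.comp_apply, topIso_inv_pointTo, CommRingCat.comp_apply,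
    CommRingCat.comp_apply] at hc
  have hc' := hc.map (Scheme.ΓSpecIso (S.residueField x)).hom.hom
  have e : (Scheme.ΓSpecIso (S.residueField x)).hom.hom ((Scheme.ΓSpecIso (S.residueField x)).inv
      (S.residue x (S.presheaf.germ V x hx c))) = S.residue x (S.presheaf.germ V x hx c) := by
    change ((Scheme.ΓSpecIso (S.residueField x)).inv ≫ (Scheme.ΓSpecIso (S.residueField x)).hom) _
      = _
    rw [Iso.inv_hom_id]
    rfl
  rw [e] at hc'
  have hg : IsUnit (S.presheaf.germ V x hx c) :=
    isUnit_of_map_unit (IsLocalRing.residue (S.presheaf.stalk x)) _ hc'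
  obtain ⟨W, i, hW, hu⟩ := S.toRingedSpace.isUnit_res_of_isUnit_germ V c x hx hg
  refine ⟨W, i.le, hW, ?_⟩
  rw [← CommRingCat.comp_apply, topIso_inv_homOfLE, CommRingCat.comp_apply]
  exact hu.map (Scheme.Opens.topIso W).inv.hom

lemma isField_Γ_Spec (k : Type u) [Field k] : IsField Γ(Spec (.of k), ⊤) :=
  (Scheme.ΓSpecIso (.of k)).commRingCatIsoToRingEquiv.toMulEquiv.isField (Field.toIsField k)

lemma exists_le_of_finite {α : Type*} [Finite α] (V : α → S.Opens) (hx : ∀ a, x ∈ V a) :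
    ∃ W : S.Opens, x ∈ W ∧ ∀ a, W ≤ V a := by
  refine ⟨⟨⋂ a, V a, isOpen_iInter_of_finite fun a => (V a).2⟩, ?_, fun a => ?_⟩
  · exact Set.mem_iInter.2 hx
  · exact Set.iInter_subset _ a

lemma exists_pointTo_eq_family {α : Type*} [Finite α] {U : S.Opens} (hU : x ∈ U)
    (k : α → Γ(Spec (S.residueField x), ⊤)) :
    ∃ (V : S.Opens) (_ : V ≤ U) (hx : x ∈ V) (c : α → Γ(V.toScheme, ⊤)),
      ∀ a, (pointTo x V hx).appTop (c a) = k a := by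
  choose V hV c hc using fun a => exists_pointTo_eq x (k a)
  obtain ⟨W, hW, hWV⟩ := exists_le_of_finite x V hV
  refine ⟨W ⊓ U, inf_le_right, ⟨hW, hU⟩,
    fun a => (S.homOfLE (inf_le_left.trans (hWV a))).appTop (c a), fun a => ?_⟩
  have e := pointTo_homOfLE x (V := W ⊓ U) (inf_le_left.trans (hWV a)) ⟨hW, hU⟩
  have e' := congrArg (fun v => Scheme.Hom.appTop v (c a)) e
  simp only [Scheme.Hom.comp_appTop, CommRingCat.comp_apply] at e'
  exact e'.trans (hc a)

lemma exists_isUnit_homOfLE_family {α : Type*} [Finite α] {V : S.Opens} (hx : x ∈ V)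
    (c : α → Γ(V.toScheme, ⊤)) (hc : ∀ a, IsUnit ((pointTo x V hx).appTop (c a))) :
    ∃ (W : S.Opens) (h : W ≤ V), x ∈ W ∧ ∀ a, IsUnit ((S.homOfLE h).appTop (c a)) := by
  choose W hWV hW hu using fun a => exists_isUnit_homOfLE x hx (c a) (hc a)
  obtain ⟨Z, hZ, hZW⟩ := exists_le_of_finite x W hW
  refine ⟨Z ⊓ V, inf_le_right, ⟨hZ, hx⟩, fun a => ?_⟩
  have e : S.homOfLE (inf_le_right : Z ⊓ V ≤ V) =
    S.homOfLE (inf_le_left.trans (hZW a)) ≫ S.homOfLE (hWV a) := by rw [Scheme.homOfLE_homOfLE]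
  rw [e, Scheme.Hom.comp_appTop, CommRingCat.comp_apply]
  exact (hu a).map (S.homOfLE (inf_le_left.trans (hZW a))).appTop.hom

lemma isUnit_fromSpecResidueField {s : Γ(S, ⊤)} (h : S.Γevaluation x s ≠ 0) :
    IsUnit ((S.fromSpecResidueField x).appTop s) := by
  have hu : IsUnit (S.Γevaluation x s) := isUnit_iff_ne_zero.2 h
  have e : (S.fromSpecResidueField x).appTop =
      S.Γevaluation x ≫ (Scheme.ΓSpecIso (S.residueField x)).inv := by
    have e₁ : (homOfLE (le_top : (⊤ : (Spec (S.presheaf.stalk x)).Opens) ≤ ⊤)).op = 𝟙 _ := rfl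
    rw [Scheme.fromSpecResidueField, Scheme.Hom.comp_appTop, Scheme.fromSpecStalk_appTop, e₁,
      CategoryTheory.Functor.map_id, Category.comp_id, Category.assoc,
      ← Scheme.ΓSpecIso_inv_naturality]
    rfl
  rw [e, CommRingCat.comp_apply]
  exact hu.map (Scheme.ΓSpecIso (S.residueField x)).inv.hom

end Points

/-! ### Splittings near a point -/

section LocalSplitting

variable {S : Scheme.{u}} {n : ℕ} {F G : Chain S n} {ι κ : Type*} [Fintype ι] [DecidableEq ι]
  [Fintype κ] [DecidableEq κ]

/-- The functions on `Spec κ(x)` carry only a ring structure that happens to be a field, whence the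
hypothesis `IsField`. -/
lemma exists_isUnit_theta_of_isField {K : Type*} [CommRing K] (hK : IsField K) (hn : 1 ≤ n)
    {u d : ℕ → Matrix κ κ K}
    (hu : ∀ i, i + 1 < n → LinearMap.ker (u i).mulVecLin = LinearMap.range (d i).mulVecLin)
    (hd : ∀ i, i + 1 < n → LinearMap.ker (d i).mulVecLin = LinearMap.range (u i).mulVecLin)
    (hu' : ∀ i, i + 2 < n → IsCompl (LinearMap.range (u i).mulVecLin)
      (LinearMap.ker (u (i + 1)).mulVecLin))
    (hd' : ∀ i, i + 2 < n → Disjoint (LinearMap.range (d (i + 1)).mulVecLin)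
      (LinearMap.ker (d i).mulVecLin)) :
    ∃ (J : Finset κ) (P Q : Matrix κ κ K), (∀ j ∉ J, ∀ k, P j k = 0) ∧ (∀ j ∈ J, ∀ k, Q j k = 0) ∧
      ∀ i < n, IsUnit (theta n u d P Q i) := by
  let := hK.toField
  exact exists_isUnit_theta (K := K) hn hu hd hu' hd'

lemma ker_upMatrix (C : Chain S n) (x : S)
    (E : ∀ i, Frame ((Scheme.Modules.pullback (S.fromSpecResidueField x)).obj (C.obj i)) κ)
    {i : ℕ} (hi : i + 1 < n) :
    LinearMap.ker (upMatrix C _ E i).mulVecLin = (LinearMap.ker (fibreMap (C.up i hi) x)).map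
      (E ⟨i, Nat.lt_of_succ_lt hi⟩).basis.equivFun.toLinearMap := by
  rw [upMatrix_of_lt _ _ _ hi, homMatrix_apply, fibreMap_eq]
  exact ker_mulVecLin_toMatrix _ _ _

lemma range_upMatrix (C : Chain S n) (x : S)
    (E : ∀ i, Frame ((Scheme.Modules.pullback (S.fromSpecResidueField x)).obj (C.obj i)) κ)
    {i : ℕ} (hi : i + 1 < n) :
    LinearMap.range (upMatrix C _ E i).mulVecLin = (LinearMap.range (fibreMap (C.up i hi) x)).map
      (E ⟨i + 1, hi⟩).basis.equivFun.toLinearMap := by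
  rw [upMatrix_of_lt _ _ _ hi, homMatrix_apply, fibreMap_eq]
  exact range_mulVecLin_toMatrix _ _ _

lemma ker_downMatrix (C : Chain S n) (x : S)
    (E : ∀ i, Frame ((Scheme.Modules.pullback (S.fromSpecResidueField x)).obj (C.obj i)) κ)
    {i : ℕ} (hi : i + 1 < n) :
    LinearMap.ker (downMatrix C _ E i).mulVecLin = (LinearMap.ker (fibreMap (C.down i hi) x)).map
      (E ⟨i + 1, hi⟩).basis.equivFun.toLinearMap := by
  rw [downMatrix_of_lt _ _ _ hi, homMatrix_apply, fibreMap_eq]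
  exact ker_mulVecLin_toMatrix _ _ _

lemma range_downMatrix (C : Chain S n) (x : S)
    (E : ∀ i, Frame ((Scheme.Modules.pullback (S.fromSpecResidueField x)).obj (C.obj i)) κ)
    {i : ℕ} (hi : i + 1 < n) :
    LinearMap.range (downMatrix C _ E i).mulVecLin =
      (LinearMap.range (fibreMap (C.down i hi) x)).map
      (E ⟨i, Nat.lt_of_succ_lt hi⟩).basis.equivFun.toLinearMap := by
  rw [downMatrix_of_lt _ _ _ hi, homMatrix_apply, fibreMap_eq]
  exact range_mulVecLin_toMatrix _ _ _

lemma exists_isUnit_theta_point (hn : 1 ≤ n) {s : Γ(S, ⊤)} (h : IsLinkedHom F G s) (x : S)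
    (E : ∀ i, Frame ((Scheme.Modules.pullback (S.fromSpecResidueField x)).obj (G.obj i)) κ) :
    ∃ (J : Finset κ) (P Q : Matrix κ κ Γ(Spec (S.residueField x), ⊤)),
      (∀ j ∉ J, ∀ k, P j k = 0) ∧ (∀ j ∈ J, ∀ k, Q j k = 0) ∧
      ∀ i < n, IsUnit (theta n (upMatrix G _ E) (downMatrix G _ E) P Q i) := by
  by_cases hs : S.Γevaluation x s = 0
  · refine exists_isUnit_theta_of_isField (isField_Γ_Spec (S.residueField x)) hn
      (fun i hi => ?_) (fun i hi => ?_) (fun i hi => ?_) fun i hi => ?_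
    · rw [ker_upMatrix _ _ _ hi, range_downMatrix _ _ _ hi, (h.ker_eq x hs i hi).1]
    · rw [ker_downMatrix _ _ _ hi, range_upMatrix _ _ _ hi, (h.ker_eq x hs i hi).2]
    · rw [range_upMatrix _ _ _ (Nat.lt_of_succ_lt hi), ker_upMatrix _ _ _ hi]
      exact isCompl_map_equiv _ (h.compl x hs i hi).1
    · rw [range_downMatrix _ _ _ hi, ker_downMatrix _ _ _ (Nat.lt_of_succ_lt hi)]
      exact (isCompl_map_equiv _ (h.compl x hs i hi).2).disjoint
  -- Where `s` does not vanish, the downward composites are invertible, and the first module alone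
  -- suffices.
  · refine ⟨Finset.univ, 1, 0, fun j hj => absurd (Finset.mem_univ j) hj, fun _ _ _ => rfl,
      fun i hi => ?_⟩
    rw [theta, one_mul, zero_mul, add_zero]
    exact isUnit_downProd (isUnit_fromSpecResidueField x hs)
      (fun i hi => downMatrix_mul_upMatrix _ _ _ _ _ hi (h.up_down i hi).2.2.1) i hi

/-- The projection to the rows in `J`. -/
def rowProj (J : Finset κ) (R : Type*) [CommRing R] : Matrix κ κ R :=
  Matrix.diagonal fun j => if j ∈ J then 1 else 0

lemma rowProj_mul_self (J : Finset κ) (R : Type*) [CommRing R] :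
    rowProj J R * rowProj J R = rowProj J R := by
  rw [rowProj, Matrix.diagonal_mul_diagonal]
  congr 1
  funext j
  split_ifs <;> simp

omit [Fintype κ] in
lemma map_rowProj (J : Finset κ) {R R' : Type*} [CommRing R] [CommRing R'] (f : R →+* R') :
    (rowProj J R).map f = rowProj J R' := by
  rw [rowProj, Matrix.diagonal_map (map_zero f), rowProj]
  congr 1
  funext j
  change f (if j ∈ J then 1 else 0) = _
  split_ifs
  · exact map_one f
  · exact map_zero f

lemma rowProj_mul_eq (J : Finset κ) {R : Type*} [CommRing R] (P : Matrix κ κ R)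
    (h : ∀ j ∉ J, ∀ k, P j k = 0) : rowProj J R * P = P := by
  ext j k
  rw [rowProj, Matrix.diagonal_mul]
  by_cases hj : j ∈ J
  · rw [if_pos hj, one_mul]
  · rw [h j hj, mul_zero]

lemma one_sub_rowProj_mul_eq (J : Finset κ) {R : Type*} [CommRing R] (Q : Matrix κ κ R)
    (h : ∀ j ∈ J, ∀ k, Q j k = 0) : (1 - rowProj J R) * Q = Q := by
  have : rowProj J R * Q = 0 := by
    ext j k
    rw [rowProj, Matrix.diagonal_mul]
    by_cases hj : j ∈ J
    · rw [h j hj, mul_zero, Matrix.zero_apply]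
    · rw [if_neg hj, zero_mul, Matrix.zero_apply]
  rw [sub_mul, one_mul, this, sub_zero]

/-- The matrices found over `κ(x)` are lifted to a neighbourhood, which is then shrunk until the
finitely many determinants of `theta` are units. -/
lemma exists_splitting (hn : 1 ≤ n) {s : Γ(S, ⊤)} (h : IsLinkedHom F G s) (x : S) (U : S.Opens)
    (hU : x ∈ U) (E : ∀ i, Frame ((Scheme.Modules.pullback U.ι).obj (F.obj i)) ι)
    (E' : ∀ i, Frame ((Scheme.Modules.pullback U.ι).obj (G.obj i)) κ) :
    ∃ (V : S.Opens) (hV : V ≤ U) (_ : x ∈ V) (P Q D : Matrix κ κ Γ(V.toScheme, ⊤)),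
      Splitting n (V.ι.appTop s)
        (upMatrix F V.ι fun i => (E i).pull (S.homOfLE hV) U.ι V.ι (S.homOfLE_ι hV))
        (downMatrix F V.ι fun i => (E i).pull (S.homOfLE hV) U.ι V.ι (S.homOfLE_ι hV))
        (upMatrix G V.ι fun i => (E' i).pull (S.homOfLE hV) U.ι V.ι (S.homOfLE_ι hV))
        (downMatrix G V.ι fun i => (E' i).pull (S.homOfLE hV) U.ι V.ι (S.homOfLE_ι hV))
        P Q D := by
  obtain ⟨J, P, Q, hP, hQ, hu⟩ := exists_isUnit_theta_point hn h x
    fun i => (E' i).pull (pointTo x U hU) U.ι _ (pointTo_ι x U hU)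
  obtain ⟨V, hVU, hV, c, hc⟩ := exists_pointTo_eq_family x hU
    (fun a : Bool × κ × κ => if a.1 then P a.2.1 a.2.2 else Q a.2.1 a.2.2)
  let EV := fun i => (E' i).pull (S.homOfLE hVU) U.ι V.ι (S.homOfLE_ι hVU)
  let D : Matrix κ κ Γ(V.toScheme, ⊤) := rowProj J _
  -- Lifts of the zero entries need not vanish. The factors `D` and `1 - D` restore the supports in
  -- rows, hence the relations `EP = P` and `EQ = 0`, and do not change the values at `x`.
  let PV : Matrix κ κ Γ(V.toScheme, ⊤) := D * .of fun j k => c (true, j, k)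
  let QV : Matrix κ κ Γ(V.toScheme, ⊤) := (1 - D) * .of fun j k => c (false, j, k)
  let f := (pointTo x V hV).appTop.hom
  have hDf : D.map f = rowProj J _ := map_rowProj J f
  have hPf : PV.map f = P := by
    have e : (Matrix.of fun j k => c (true, j, k)).map f = P := by
      ext j k
      exact hc (true, j, k)
    rw [Matrix.map_mul, hDf, e, rowProj_mul_eq J P hP]
  have hQf : QV.map f = Q := by
    have e : (Matrix.of fun j k => c (false, j, k)).map f = Q := by
      ext j k
      exact hc (false, j, k)
    rw [Matrix.map_mul, Matrix.map_sub _ (map_sub f), hDf, e,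
      Matrix.map_one _ (map_zero f) (map_one f), one_sub_rowProj_mul_eq J Q hQ]
  have hpt : (fun i => (EV i).pull (pointTo x V hV) V.ι _ (pointTo_ι x V hV)) =
      fun i => (E' i).pull (pointTo x U hU) U.ι _ (pointTo_ι x U hU) := by
    funext i
    exact Frame.pull_pull _ _ _ (pointTo_homOfLE x hVU hV) _ _ _ _ _ _ _
  -- At `x` these matrices specialise to those of the fibre, which are invertible.
  have hdet : ∀ i : Fin n, IsUnit (f (theta n (upMatrix G V.ι EV) (downMatrix G V.ι EV)
      PV QV i).det) := by
    intro i
    rw [RingHom.map_det, RingHom.mapMatrix_apply, map_theta, ← upMatrix_pull (h := pointTo_ι x V hV),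
      ← downMatrix_pull (h := pointTo_ι x V hV), hPf, hQf, hpt]
    exact (Matrix.isUnit_iff_isUnit_det _).1 (hu i i.2)
  obtain ⟨W, hWV, hW, hWu⟩ := exists_isUnit_homOfLE_family x hV _ hdet
  let g := (S.homOfLE hWV).appTop.hom
  have hpull : (fun i => (E' i).pull (S.homOfLE (hWV.trans hVU)) U.ι W.ι (S.homOfLE_ι _)) =
      fun i => (EV i).pull (S.homOfLE hWV) V.ι W.ι (S.homOfLE_ι hWV) := by
    funext i
    exact (Frame.pull_pull _ _ _ (S.homOfLE_homOfLE hWV hVU) _ _ _ _ _ _ _).symm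
  have hEg : (D.map g) * (D.map g) = D.map g := by rw [← Matrix.map_mul, rowProj_mul_self]
  refine ⟨W, hWV.trans hVU, hW, PV.map g, QV.map g, D.map g,
    fun i hi => ?_, fun i hi => ?_, fun i hi => ?_, fun i hi => ?_, hEg, ?_, ?_, fun i hi => ?_⟩
  · exact downMatrix_mul_upMatrix _ _ _ _ _ hi (h.up_down i hi).1
  · exact upMatrix_mul_downMatrix _ _ _ _ _ hi (h.up_down i hi).2.1
  · exact downMatrix_mul_upMatrix _ _ _ _ _ hi (h.up_down i hi).2.2.1
  · exact upMatrix_mul_downMatrix _ _ _ _ _ hi (h.up_down i hi).2.2.2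
  · rw [← Matrix.map_mul, ← mul_assoc, rowProj_mul_self]
  · rw [← Matrix.map_mul, ← mul_assoc, mul_sub, mul_one, rowProj_mul_self, sub_self, zero_mul,
      Matrix.map_zero _ (map_zero g)]
  · rw [hpull, upMatrix_pull, downMatrix_pull, ← map_theta, Matrix.isUnit_iff_isUnit_det,
      ← RingHom.mapMatrix_apply, ← RingHom.map_det]
    exact hWu ⟨i, hi⟩

end LocalSplitting

/-! ### Local frames of vector bundles and the theorem -/

section Main

variable {S : Scheme.{u}} {n r : ℕ}

lemma IsVectorBundle.exists_frame {M : S.Modules} (h : IsVectorBundle M r) (x : S) :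
    ∃ U : S.Opens, x ∈ U ∧ Nonempty (Frame ((Scheme.Modules.pullback U.ι).obj M) (Fin r)) := by
  obtain ⟨U, hU, ⟨e⟩⟩ := h x
  exact ⟨U, hU, ⟨((freeFrame U.toScheme (ULift.{u} (Fin r))).ofIso
    (e.symm ≪≫ (Scheme.Modules.restrictFunctorIsoPullback U.ι).app M)).reindex Equiv.ulift⟩⟩

lemma exists_frames (C : Chain S n) (h : ∀ i, IsVectorBundle (C.obj i) r) (x : S) :
    ∃ U : S.Opens, x ∈ U ∧
      Nonempty (∀ i, Frame ((Scheme.Modules.pullback U.ι).obj (C.obj i)) (Fin r)) := by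
  choose U hU E using fun i => (h i).exists_frame x
  obtain ⟨V, hV, hVU⟩ := exists_le_of_finite x U hU
  exact ⟨V, hV, ⟨fun i => (E i).some.pull (S.homOfLE (hVU i)) (U i).ι V.ι (S.homOfLE_ι _)⟩⟩

end Main

end LinkedHom

theorem theorem1p1 (S : Scheme.{u}) (r m n : ℕ) (hn : 1 ≤ n) (F G : LinkedHom.Chain S n)
    (hF : ∀ i, LinkedHom.IsVectorBundle (F.obj i) r)
    (hG : ∀ i, LinkedHom.IsVectorBundle (G.obj i) m)
    (h : ∃ s : Γ(S, ⊤), LinkedHom.IsLinkedHom F G s) :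
    LinkedHom.RepresentedByVectorBundle (LinkedHom.linkedHom F G) (r * m) := by
  obtain ⟨s, hs⟩ := h
  refine LinkedHom.representedByVectorBundle_of_charts (LinkedHom.isZariskiSheaf_linkedHom F G)
    fun x => ?_
  obtain ⟨U₁, hx₁, ⟨E₁⟩⟩ := LinkedHom.exists_frames F hF x
  obtain ⟨U₂, hx₂, ⟨E₂⟩⟩ := LinkedHom.exists_frames G hG x
  -- The two chains have frames on different neighbourhoods, so both sets of frames are restricted
  -- to the intersection.
  obtain ⟨V, hV, hx, P, Q, D, hD⟩ := LinkedHom.exists_splitting hn hs x (U₁ ⊓ U₂) ⟨hx₁, hx₂⟩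
    (fun i => (E₁ i).pull (S.homOfLE inf_le_left) U₁.ι _ (S.homOfLE_ι _))
    (fun i => (E₂ i).pull (S.homOfLE inf_le_right) U₂.ι _ (S.homOfLE_ι _))
  exact ⟨V, hx, LinkedHom.splitChart hn V _ _ _ P Q D hD,
    LinkedHom.splitChart_isLinearMap hn V _ _ _ P Q D hD⟩

end
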